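/- Let $\mathbb T=[0,2\pi]$ be the flat torus, and let $f_0(\theta,v)=F(e_0(\theta,v))$ with $e_0(\theta,v)=\frac{v^2}{2}+\phi_0(\theta)$, $\phi_0(\theta)=-m_0\cos\theta$, $m_0>0$, where $\phi_0$ is the self-consistent potential of $f_0$: $\phi_0(\theta)=-\int_0^{2\pi}\rho_{f_0}(\theta')\cos(\theta-\theta')\,d\theta'$, $\rho_{f_0}(\theta)=\int_{\mathbb R}f_0(\theta,v)\,dv$. Assume that $F:\mathbb R\to\mathbb R$ is continuous and that, for some $e_*\in\mathbb R\cup\{+\infty\}$, $F$ is $\mathcal C^1$ with $F'<0$ on $(-\infty,e_*)$; that $F=0$ on $[e_*,+\infty)$ if $e_*<+\infty$, and $\lim_{e\to+\infty}F(e)=0$ if $e_*=+\infty$; that $f_0\in L^1((1+|v|^2)\,d\theta dv)$; and, in the case $e_*=m_0$, that $\int_{-m_0}^{m_0}\log(m_0-e)F'(e)\,de<+\infty$. Let $\mu_{f_0}(t)=|\{(\theta,v)\in\mathbb T\times\mathbb R: f_0(\theta,v)>t\}|$ and $f_0^\sharp(s)=\inf\{t\ge 0:\mu_{f_0}(t)\le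 s\}$ for $s\geq 0$. For $m\ge 0$ put $\phi(\theta)=-m\cos\theta$, $e(\theta,v)=\frac{v^2}{2}+\phi(\theta)$, $a_\phi(e)=|\{(\theta,v)\in\mathbb T\times\mathbb R:\frac{v^2}{2}+\phi(\theta)<e\}|$ and $f_0^{*\phi}(\theta,v)=f_0^\sharp(a_\phi(e(\theta,v)))$. Then the integral in $$\mathcal J(m)=\frac{m^2}{2}+\iint\Big(\frac{v^2}{2}-m\cos\theta\Big)f_0^{*\phi}(\theta,v)\,d\theta dv$$ converges absolutely for every $m\ge0$, and the function $\mathcal J$ is $\mathcal C^1$ on $[0,+\infty)$ and $\mathcal C^2$ on $(0,+\infty)$. For every $m\ge 0$ (with a one-sided derivative at $m=0$), the following integral converges absolutely and $$\mathcal J'(m)=m-\iint f_0^{*\phi}(\theta,v)\cos\theta\,d\theta dv .$$ For every $m>0$, $$\mathcal J''(m)=1+\iint (f_0^\sharp\circ a_\phi)'(e(\theta,v))\left(\cos\theta-\frac{\int_0^{\theta_m(e(\theta,v))}\cos\theta'\,(e(\theta,v)+m\cos\theta')^{-1/2}\,d\theta'}{\int_0^{\theta_m(e(\theta,v))}(e(\theta,v)+m\cos\theta')^{-1/2}\,d\theta'}\right)^2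 d\theta dv ,$$ where $\theta_m(e)=0$ if $e\le -m$, $\theta_m(e)=\arccos(-e/m)$ if $-m<e<m$, and $\theta_m(e)=\pi$ if $e\ge m$. Here, for almost every $(\theta,v)$, the derivative $(f_0^\sharp\circ a_\phi)'(e(\theta,v))$ exists, the integrals over $[0,\theta_m(e(\theta,v))]$ converge and the denominator is positive, and the double integral converges absolutely. -/

import Mathlib

open Real Set Filter Topology MeasureTheory

noncomputable section

namespace HMF

/-- The Lebesgue measure `dθ dv` on the phase space `𝕋 × ℝ`, where the flat torus `𝕋` is
`[0, 2π]`. A point `p` of phase space is the pair `(θ, v) = (p.1, p.2)`. -/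
def phase : Measure (ℝ × ℝ) := (volume.restrict (Icc 0 (2 * π))).prod volume

/-- The microscopic energy `e(θ, v) = v² / 2 + φ(θ)`. -/
def energy (φ : ℝ → ℝ) (p : ℝ × ℝ) : ℝ := p.2 ^ 2 / 2 + φ p.1

/-- The HMF potential `φ(θ) = - m cos θ`. -/
def cosPot (m : ℝ) (θ : ℝ) : ℝ := -m * cos θ

/-- The density `ρ_f(θ) = ∫ f(θ, v) dv`. -/
def density (f : ℝ × ℝ → ℝ) (θ : ℝ) : ℝ := ∫ v : ℝ, f (θ, v)

/-- The self-consistent potential `φ_f(θ) = - ∫₀^{2π} ρ_f(θ') cos (θ - θ') dθ'`. -/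
def selfPot (f : ℝ × ℝ → ℝ) (θ : ℝ) : ℝ :=
  -∫ θ' in (0 : ℝ)..(2 * π), density f θ' * cos (θ - θ')

/-- The distribution function `μ_f(t) = |{f > t}|`. -/
def distrib (f : ℝ × ℝ → ℝ) (t : ℝ) : ENNReal := phase {p | t < f p}

/-- The pseudo-inverse `f^♯(s) = inf {t ≥ 0 : μ_f(t) ≤ s}` of the distribution function,
for `s ≥ 0`. The set is nonempty as soon as `f` is integrable and `s > 0`, or `f` is bounded
above. -/
def sharp (f : ℝ × ℝ → ℝ) (s : ℝ) : ℝ := sInf {t : ℝ | 0 ≤ t ∧ distrib f t ≤ ENNReal.ofReal s}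

/-- `a_φ(e) = |{(θ, v) : v² / 2 + φ(θ) < e}|` (a finite number when `φ` is bounded below). -/
def area (φ : ℝ → ℝ) (e : ℝ) : ℝ := (phase {p | energy φ p < e}).toReal

/-- The rearrangement `f^{*φ}(θ, v) = f^♯ (a_φ (v² / 2 + φ(θ)))` of `f` with respect to the
microscopic energy. -/
def rearr (f : ℝ × ℝ → ℝ) (φ : ℝ → ℝ) (p : ℝ × ℝ) : ℝ := sharp f (area φ (energy φ p))

/-- The angle `θ_m(e)`. -/
def angle (m e : ℝ) : ℝ := if e ≤ -m then 0 else if e < m then arccos (-e / m) else π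

/-- `∫₀^{θ_m(e)} (e + m cos θ')^{-1/2} dθ'`. -/
def orbitWeight (m e : ℝ) : ℝ := ∫ θ' in (0 : ℝ)..(angle m e), 1 / √(e + m * cos θ')

/-- The average of `cos` over the orbit of energy `e`, i.e. the quotient of
`∫₀^{θ_m(e)} cos θ' (e + m cos θ')^{-1/2} dθ'` by `∫₀^{θ_m(e)} (e + m cos θ')^{-1/2} dθ'`. -/
def orbitCos (m e : ℝ) : ℝ :=
  (∫ θ' in (0 : ℝ)..(angle m e), cos θ' / √(e + m * cos θ')) / orbitWeight m e

/-- The reduced energy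
`J(m) = m² / 2 + ∬ (v² / 2 - m cos θ) f^{*φ} dθ dv`, with `φ(θ) = - m cos θ`. -/
def reducedEnergy (f : ℝ × ℝ → ℝ) (m : ℝ) : ℝ :=
  m ^ 2 / 2 + ∫ p, energy (cosPot m) p * rearr f (cosPot m) p ∂phase

/-- `f₀(θ, v) = F (v² / 2 - m₀ cos θ)`. -/
def steady (F : ℝ → ℝ) (m₀ : ℝ) (p : ℝ × ℝ) : ℝ := F (energy (cosPot m₀) p)

/-- The standing assumptions on the stationary state `f₀ = F(e₀)`, `e₀ = v² / 2 - m₀ cos θ`, and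
on its profile `F` with cut-off energy `e_* ∈ ℝ ∪ {+∞}`. -/
structure IsSteadyState (F : ℝ → ℝ) (eStar : WithTop ℝ) (m₀ : ℝ) : Prop where
  m₀_pos : 0 < m₀
  selfPot_eq : ∀ θ, selfPot (steady F m₀) θ = cosPot m₀ θ
  continuous : Continuous F
  contDiffOn : ContDiffOn ℝ 1 F {e : ℝ | (e : WithTop ℝ) < eStar}
  deriv_neg : ∀ e : ℝ, (e : WithTop ℝ) < eStar → deriv F e < 0
  eq_zero : ∀ e : ℝ, eStar ≤ (e : WithTop ℝ) → F e = 0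
  tendsto_zero : eStar = ⊤ → Tendsto F atTop (𝓝 0)
  integrable : Integrable (fun p : ℝ × ℝ => (1 + p.2 ^ 2) * steady F m₀ p) phase
  integrable_log : eStar = (m₀ : WithTop ℝ) →
    IntegrableOn (fun e => log (m₀ - e) * deriv F e) (Ioo (-m₀) m₀)

end HMF

end

noncomputable section

namespace HMF


/-! Write `Q` for the profile `F ∘ a⁻¹`, with `a` the area function of `φ₀`; it is `f₀^♯` on the
half line, is continuous, and decreases to `0`. The measure `-dQ` on `(0, ∞)` therefore has no
atoms, and `Q(r)` is its mass beyond `r`. By this layer-cake formula every integral of `f₀^{*φ}`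
becomes an integral over `s` of integrals over the sublevel set of `e` that has area `s`
(`IsProfile.integral_eq_layers`). No derivative of `F` is needed for that.

First derivative. Among the sublevel sets of area `s` for the various `m`, the one for `m'` has the
least energy `e_{m'}` (`setIntegral_energy_le`). Hence `m' ↦ ∬ e_{m'} f₀^{*φ_m}`, which is affine
with slope `-∬ f₀^{*φ_m} cos θ`, lies above `meanEnergy` and touches it at `m`. A function with
continuous supporting slopes is `C¹`; their continuity, at `m = 0` too, is dominated convergence
with the bound of `IsSteadyState.isProfile`.

Second derivative. For `m > 0` a scaling reduces everything to the potential `-cos`: the integral of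
`cos θ` over the sublevel set of area `s` is `√m · cosArea (s / √m)`. The function `cosArea` is
1-Lipschitz on the half line, and differentiable at positive areas except at the separatrix. For
each `m` this excludes one `s`, a null set of layers, so the magnetization can be differentiated
under the integral (`IsProfile.hasDerivAt_magnetization`).

Identification. An algebraic identity shows that the layer derivative is the integral of `(cos θ -
average)²` over an orbit (`orbitVar_eq`). The layers are carried by `s ↦ e` to the measure `-(Q ∘
a_φ)'(e) de` (`IsProfile.map_levelEnergy`), and Fubini in the coordinates `(θ, e)` yields the double
integral. -/

/-! ### Sublevel sets of the energy -/

/-- The weighted area `∬_{e < E} w(θ) dθ dv` of a sublevel set of `e = v² / 2 - m cos θ`, written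
as an integral over the angle. -/
def slab (w : ℝ → ℝ) (m e : ℝ) : ℝ :=
  ∫ θ in (0 : ℝ)..(2 * π), w θ * (2 * √(2 * (e + m * cos θ)))

instance : SFinite phase := by unfold phase; infer_instance

instance : SigmaFinite phase := by unfold phase; infer_instance

lemma two_pi_nonneg : (0 : ℝ) ≤ 2 * π := by positivity

lemma energy_cosPot (m : ℝ) (p : ℝ × ℝ) : energy (cosPot m) p = p.2 ^ 2 / 2 - m * cos p.1 := by
  simp only [energy, cosPot]; ring

lemma continuous_energy_cosPot : Continuous fun q : ℝ × (ℝ × ℝ) => energy (cosPot q.1) q.2 := by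
  simp only [energy_cosPot]; fun_prop

lemma continuous_energy (m : ℝ) : Continuous (energy (cosPot m)) := by
  have : energy (cosPot m) = fun p : ℝ × ℝ => p.2 ^ 2 / 2 - m * cos p.1 :=
    funext (energy_cosPot m)
  rw [this]; fun_prop

lemma neg_le_energy {m : ℝ} (hm : 0 ≤ m) (p : ℝ × ℝ) : -m ≤ energy (cosPot m) p := by
  rw [energy_cosPot]; nlinarith [sq_nonneg p.2, cos_le_one p.1]

lemma setOf_sq_lt (a : ℝ) : {v : ℝ | v ^ 2 / 2 < a} = Ioo (-√(2 * a)) (√(2 * a)) := by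
  ext v
  rw [mem_ofPred_eq, mem_Ioo, ← abs_lt, lt_sqrt (abs_nonneg v), sq_abs]
  constructor <;> intro h <;> linarith

lemma slice_energy (m E θ : ℝ) :
    {v : ℝ | energy (cosPot m) (θ, v) < E} =
      Ioo (-√(2 * (E + m * cos θ))) (√(2 * (E + m * cos θ))) := by
  rw [← setOf_sq_lt]
  ext v
  simp only [energy_cosPot, mem_ofPred_eq]
  constructor <;> intro h <;> linarith

lemma measurableSet_sublevel (m E : ℝ) : MeasurableSet {p | energy (cosPot m) p < E} :=
  (isOpen_lt (continuous_energy m) continuous_const).measurableSet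

lemma slab_eq_setIntegral (w : ℝ → ℝ) (m e : ℝ) :
    slab w m e = ∫ θ in Icc 0 (2 * π), w θ * (2 * √(2 * (e + m * cos θ))) := by
  rw [slab, intervalIntegral.integral_of_le two_pi_nonneg, integral_Icc_eq_integral_Ioc]

lemma phase_sublevel (m E : ℝ) :
    phase {p | energy (cosPot m) p < E} = ENNReal.ofReal (slab (fun _ => 1) m E) := by
  rw [phase, Measure.prod_apply (measurableSet_sublevel m E), slab_eq_setIntegral,
    ofReal_integral_eq_lintegral_ofReal]
  · refine lintegral_congr fun θ => ?_
    have : Prod.mk θ ⁻¹' {p | energy (cosPot m) p < E} = {v | energy (cosPot m) (θ, v) < E} := rfl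
    rw [this, slice_energy, Real.volume_Ioo]
    congr 1; ring
  · exact Continuous.integrableOn_Icc (by fun_prop)
  · exact Eventually.of_forall fun θ => by positivity

lemma area_eq_slab (m E : ℝ) : area (cosPot m) E = slab (fun _ => 1) m E := by
  rw [area, phase_sublevel, ENNReal.toReal_ofReal]
  rw [slab_eq_setIntegral]
  exact integral_nonneg fun θ => by positivity

lemma area_nonneg (φ : ℝ → ℝ) (E : ℝ) : 0 ≤ area φ E := ENNReal.toReal_nonneg

lemma phase_sublevel_eq_area (m E : ℝ) :
    phase {p | energy (cosPot m) p < E} = ENNReal.ofReal (area (cosPot m) E) := by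
  rw [phase_sublevel, area_eq_slab]

lemma setIntegral_sublevel {w : ℝ → ℝ} (hw : Continuous w) (hb : ∀ θ, |w θ| ≤ 1) (m E : ℝ) :
    ∫ p in {p | energy (cosPot m) p < E}, w p.1 ∂phase = slab w m E := by
  have hfin : phase {p | energy (cosPot m) p < E} ≠ ⊤ := by
    rw [phase_sublevel]; exact ENNReal.ofReal_ne_top
  have hint : IntegrableOn (fun p : ℝ × ℝ => w p.1) {p | energy (cosPot m) p < E} phase :=
    Measure.integrableOn_of_bounded hfin (by fun_prop) (M := 1)
      (Eventually.of_forall fun p => hb p.1)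
  rw [← integral_indicator (measurableSet_sublevel m E)]
  rw [← integrable_indicator_iff (measurableSet_sublevel m E)] at hint
  rw [phase] at hint ⊢
  rw [integral_prod _ hint, slab_eq_setIntegral]
  refine integral_congr_ae (Eventually.of_forall fun θ => ?_)
  have : (fun v => indicator {p | energy (cosPot m) p < E} (fun p : ℝ × ℝ => w p.1) (θ, v)) =
      indicator {v | energy (cosPot m) (θ, v) < E} fun _ => w θ := by
    ext v; simp [indicator]
  simp only [this]
  rw [slice_energy, integral_indicator measurableSet_Ioo, setIntegral_const, smul_eq_mul,
    measureReal_def, Real.volume_Ioo, ENNReal.toReal_ofReal]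
  · ring
  · linarith [sqrt_nonneg (2 * (E + m * cos θ))]

/-! ### Elementary properties of the area function -/

lemma continuous_slab {w : ℝ → ℝ} (hw : Continuous w) :
    Continuous fun q : ℝ × ℝ => slab w q.1 q.2 := by
  unfold slab
  exact intervalIntegral.continuous_parametric_intervalIntegral_of_continuous' (by fun_prop) _ _

/-- Measuring energies in units of `m` leaves the single potential `-cos`. Orbit integrals then
never have to be differentiated in `m`: the parameter enters through `√m` and through the argument
only. -/
lemma slab_scaling (w : ℝ → ℝ) {m : ℝ} (hm : 0 < m) (e : ℝ) :
    slab w m e = √m * slab w 1 (e / m) := by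
  rw [slab, slab, ← intervalIntegral.integral_const_mul]
  refine intervalIntegral.integral_congr fun θ _ => ?_
  have : 2 * (e + m * cos θ) = m * (2 * (e / m + 1 * cos θ)) := by field_simp
  simp only [this]
  rw [sqrt_mul hm.le]; ring

lemma continuous_area : Continuous fun q : ℝ × ℝ => area (cosPot q.1) q.2 := by
  simp only [area_eq_slab]; exact continuous_slab continuous_const

lemma area_mono (m : ℝ) : Monotone (area (cosPot m)) := by
  intro a b hab
  rw [area, area]
  refine ENNReal.toReal_mono ?_ (measure_mono fun p (hp : _ < a) => lt_of_lt_of_le hp hab)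
  rw [phase_sublevel]; exact ENNReal.ofReal_ne_top

lemma area_eq_zero {m e : ℝ} (hm : 0 ≤ m) (he : e ≤ -m) : area (cosPot m) e = 0 := by
  have : {p | energy (cosPot m) p < e} = ∅ := by
    ext p; simpa using he.trans (neg_le_energy hm p)
  rw [area, this]; simp

/-- The fibre length is monotone in the energy and the weight is at most `1` in modulus.
Consequently weighted areas are 1-Lipschitz as functions of the area, across the separatrix as well.
-/
lemma abs_slab_sub_le {w : ℝ → ℝ} (hw : Continuous w) (hb : ∀ θ, |w θ| ≤ 1) (m : ℝ) {a b : ℝ}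
    (hab : a ≤ b) : |slab w m b - slab w m a| ≤ area (cosPot m) b - area (cosPot m) a := by
  rw [area_eq_slab, area_eq_slab, slab, slab, slab, slab,
    ← intervalIntegral.integral_sub (Continuous.intervalIntegrable (by fun_prop) _ _)
      (Continuous.intervalIntegrable (by fun_prop) _ _),
    ← intervalIntegral.integral_sub (Continuous.intervalIntegrable (by fun_prop) _ _)
      (Continuous.intervalIntegrable (by fun_prop) _ _)]
  refine (intervalIntegral.abs_integral_le_integral_abs two_pi_nonneg).trans ?_
  refine intervalIntegral.integral_mono_on two_pi_nonneg
    (Continuous.intervalIntegrable (by fun_prop) _ _)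
    (Continuous.intervalIntegrable (by fun_prop) _ _) fun θ _ => ?_
  have h : √(2 * (a + m * cos θ)) ≤ √(2 * (b + m * cos θ)) := sqrt_le_sqrt (by linarith)
  have h' : 0 ≤ 2 * √(2 * (b + m * cos θ)) - 2 * √(2 * (a + m * cos θ)) := by linarith
  rw [← mul_sub (w θ), ← mul_sub 1, abs_mul, abs_of_nonneg h']
  exact mul_le_mul_of_nonneg_right (hb θ) h'

lemma slab_eq_zero (w : ℝ → ℝ) {m e : ℝ} (hm : 0 ≤ m) (he : e ≤ -m) : slab w m e = 0 := by
  rw [slab]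
  refine intervalIntegral.integral_zero_ae (Eventually.of_forall fun θ _ => ?_)
  rw [sqrt_eq_zero_of_nonpos (by nlinarith [cos_le_one θ])]; simp

lemma abs_slab_le {w : ℝ → ℝ} (hw : Continuous w) (hb : ∀ θ, |w θ| ≤ 1) {m : ℝ} (hm : 0 ≤ m)
    (e : ℝ) : |slab w m e| ≤ area (cosPot m) e := by
  rcases le_total e (-m) with h | h
  · rw [slab_eq_zero w hm h, abs_zero]; exact area_nonneg _ _
  · simpa [slab_eq_zero w hm le_rfl, area_eq_zero hm le_rfl] using abs_slab_sub_le hw hb m h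

lemma area_strictMonoOn (m : ℝ) : StrictMonoOn (area (cosPot m)) (Ici (-m)) := by
  intro a ha b _ hab
  rw [mem_Ici] at ha
  rw [area_eq_slab, area_eq_slab, slab, slab]
  refine intervalIntegral.integral_lt_integral_of_continuousOn_of_le_of_exists_lt
    (by positivity) (Continuous.continuousOn (by fun_prop)) (Continuous.continuousOn (by fun_prop))
    (fun θ _ => ?_) ⟨0, ⟨le_rfl, two_pi_nonneg⟩, ?_⟩
  · have h : √(2 * (a + m * cos θ)) ≤ √(2 * (b + m * cos θ)) := sqrt_le_sqrt (by linarith)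
    linarith
  · have h : √(2 * (a + m * cos 0)) < √(2 * (b + m * cos 0)) := by
      rw [cos_zero]; exact sqrt_lt_sqrt (by linarith) (by linarith)
    linarith

lemma le_area {m e : ℝ} (hm : 0 ≤ m) : 2 * π * (2 * √(2 * (e - m))) ≤ area (cosPot m) e := by
  rw [area_eq_slab, slab]
  have : (2 * π * (2 * √(2 * (e - m)))) = ∫ θ in (0 : ℝ)..(2 * π), (2 * √(2 * (e - m))) := by
    rw [intervalIntegral.integral_const, sub_zero, smul_eq_mul]
  rw [this]
  refine intervalIntegral.integral_mono_on two_pi_nonneg (by simp)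
    (Continuous.intervalIntegrable (by fun_prop) _ _) fun θ _ => ?_
  have h : √(2 * (e - m)) ≤ √(2 * (e + m * cos θ)) :=
    sqrt_le_sqrt (by nlinarith [neg_one_le_cos θ])
  linarith

lemma tendsto_area {m : ℝ} (hm : 0 ≤ m) : Tendsto (area (cosPot m)) atTop atTop := by
  refine tendsto_atTop_mono (fun e => le_area hm) ?_
  refine Tendsto.const_mul_atTop (by positivity) (Tendsto.const_mul_atTop two_pos ?_)
  refine tendsto_sqrt_atTop.comp (Tendsto.const_mul_atTop two_pos ?_)
  exact tendsto_atTop_add_const_right _ _ tendsto_id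

lemma continuous_area_right (m : ℝ) : Continuous (area (cosPot m)) :=
  continuous_area.comp (by fun_prop : Continuous fun e : ℝ => (m, e))

lemma exists_area_eq {m s : ℝ} (hm : 0 ≤ m) (hs : 0 ≤ s) :
    ∃ E, -m ≤ E ∧ area (cosPot m) E = s := by
  obtain ⟨b, hb, hb'⟩ := ((tendsto_area hm).eventually_ge_atTop s |>.and
    (eventually_ge_atTop (-m))).exists
  obtain ⟨E, hE, hE'⟩ := intermediate_value_Icc hb' (continuous_area_right m).continuousOn
    ⟨(area_eq_zero hm le_rfl).le.trans hs, hb⟩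
  exact ⟨E, hE.1, hE'⟩

lemma area_lt_iff {m a b : ℝ} (ha : -m ≤ a) (hb : -m ≤ b) :
    area (cosPot m) a < area (cosPot m) b ↔ a < b :=
  (area_strictMonoOn m).lt_iff_lt ha hb

lemma setOf_area_lt {m E : ℝ} (hm : 0 ≤ m) (hE : -m ≤ E) :
    {p | area (cosPot m) (energy (cosPot m) p) < area (cosPot m) E} =
      {p | energy (cosPot m) p < E} := by
  ext p; exact area_lt_iff (neg_le_energy hm p) hE

/-- `a_φ ∘ e` transports the phase-space measure to Lebesgue measure on the half line. -/
lemma phase_area_lt {m s : ℝ} (hm : 0 ≤ m) (hs : 0 ≤ s) :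
    phase {p | area (cosPot m) (energy (cosPot m) p) < s} = ENNReal.ofReal s := by
  obtain ⟨E, hE, rfl⟩ := exists_area_eq hm hs
  rw [setOf_area_lt hm hE, phase_sublevel_eq_area]


/-! ### The inverse of the area function -/

/-- The area vanishes below the minimum `-1` of the energy. The added term is nonzero only there and
makes the function an increasing bijection of the line, whose inverse is continuous and strictly
monotone without further work. -/
lemma strictMono_area_add_min : StrictMono fun x => area (cosPot 1) x + min (x + 1) 0 := by
  intro a b hab
  rcases lt_or_ge a (-1) with h | h
  · have h1 : min (a + 1) 0 = a + 1 := min_eq_left (by linarith)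
    have h2 : a + 1 < min (b + 1) 0 := lt_min (by linarith) (by linarith)
    have h3 := area_mono 1 hab.le
    simp only [h1]; linarith
  · have h1 : min (a + 1) 0 = 0 := min_eq_right (by linarith)
    have h2 : min (b + 1) 0 = 0 := min_eq_right (by linarith)
    have h3 := area_strictMonoOn 1 h (h.trans hab.le) hab
    simp only [h1, h2]; linarith

lemma surjective_area_add_min :
    Function.Surjective fun x => area (cosPot 1) x + min (x + 1) 0 := by
  intro y
  rcases le_total 0 y with h | h
  · obtain ⟨E, hE, h'⟩ := exists_area_eq zero_le_one h
    refine ⟨E, ?_⟩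
    have h1 : min (E + 1) 0 = 0 := min_eq_right (by linarith)
    simp only [h1, h', add_zero]
  · refine ⟨y - 1, ?_⟩
    have h1 : min (y - 1 + 1) 0 = y := by rw [sub_add_cancel]; exact min_eq_left h
    simp only [h1, area_eq_zero zero_le_one (show y - 1 ≤ -1 by linarith), zero_add]

/-- The function `a_φ`, for `φ = - cos`, extended to an order isomorphism of the line. -/
def areaIso : ℝ ≃o ℝ :=
  strictMono_area_add_min.orderIsoOfSurjective _ surjective_area_add_min

/-- The inverse of `a_φ : [-1, ∞) → [0, ∞)`, for `φ = - cos`. -/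
def invArea (y : ℝ) : ℝ := areaIso.symm y

lemma continuous_invArea : Continuous invArea := areaIso.symm.continuous

lemma strictMono_invArea : StrictMono invArea := areaIso.symm.strictMono

lemma invArea_area {x : ℝ} (hx : -1 ≤ x) : invArea (area (cosPot 1) x) = x := by
  have h : areaIso x = area (cosPot 1) x := by
    have h1 : min (x + 1) 0 = 0 := min_eq_right (by linarith)
    change area (cosPot 1) x + min (x + 1) 0 = _
    rw [h1, add_zero]
  rw [← h]; exact areaIso.symm_apply_apply x

lemma area_invArea {y : ℝ} (hy : 0 ≤ y) : area (cosPot 1) (invArea y) = y := by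
  obtain ⟨E, hE, rfl⟩ := exists_area_eq zero_le_one hy
  rw [invArea_area hE]

lemma neg_one_le_invArea {y : ℝ} (hy : 0 ≤ y) : -1 ≤ invArea y := by
  obtain ⟨E, hE, rfl⟩ := exists_area_eq zero_le_one hy
  rwa [invArea_area hE]

lemma neg_one_lt_invArea {y : ℝ} (hy : 0 < y) : -1 < invArea y := by
  have : invArea 0 = -1 := by
    rw [← area_eq_zero zero_le_one le_rfl, invArea_area le_rfl]
  rw [← this]; exact strictMono_invArea hy

lemma area_scaling {m : ℝ} (hm : 0 < m) (e : ℝ) :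
    area (cosPot m) e = √m * area (cosPot 1) (e / m) := by
  rw [area_eq_slab, area_eq_slab, slab_scaling _ hm]

/-- The energy `e ≥ -m` with `a_φ(e) = s`, for `φ = - m cos` and `m > 0`. -/
def levelEnergy (m s : ℝ) : ℝ := m * invArea (s / √m)

lemma area_levelEnergy {m s : ℝ} (hm : 0 < m) (hs : 0 ≤ s) :
    area (cosPot m) (levelEnergy m s) = s := by
  have := sqrt_pos.2 hm
  rw [area_scaling hm, levelEnergy, mul_div_cancel_left₀ _ hm.ne', area_invArea (by positivity)]
  field_simp

lemma levelEnergy_area {m e : ℝ} (hm : 0 < m) (he : -m ≤ e) :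
    levelEnergy m (area (cosPot m) e) = e := by
  have := sqrt_pos.2 hm
  rw [area_scaling hm, levelEnergy, mul_div_cancel_left₀ _ this.ne', invArea_area]
  · field_simp
  · rw [le_div_iff₀ hm]; linarith

lemma neg_le_levelEnergy {m s : ℝ} (hm : 0 < m) (hs : 0 ≤ s) : -m ≤ levelEnergy m s := by
  have := neg_one_le_invArea (show 0 ≤ s / √m by positivity)
  rw [levelEnergy]; nlinarith

lemma neg_lt_levelEnergy {m s : ℝ} (hm : 0 < m) (hs : 0 < s) : -m < levelEnergy m s := by
  have h := sqrt_pos.2 hm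
  have := neg_one_lt_invArea (show 0 < s / √m by positivity)
  rw [levelEnergy]; nlinarith

lemma strictMono_levelEnergy {m : ℝ} (hm : 0 < m) : StrictMono (levelEnergy m) := by
  have h := sqrt_pos.2 hm
  intro a b hab
  rw [levelEnergy, levelEnergy]
  exact mul_lt_mul_of_pos_left (strictMono_invArea (div_lt_div_of_pos_right hab h)) hm

lemma continuous_levelEnergy (m : ℝ) : Continuous (levelEnergy m) :=
  continuous_const.mul (continuous_invArea.comp (continuous_id.div_const _))

lemma lt_levelEnergy_iff {m e s : ℝ} (hm : 0 < m) (he : -m ≤ e) (hs : 0 ≤ s) :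
    e < levelEnergy m s ↔ area (cosPot m) e < s := by
  conv_rhs => rw [← area_levelEnergy hm hs]
  exact (area_lt_iff he (neg_le_levelEnergy hm hs)).symm

lemma tendsto_invArea : Tendsto invArea atTop atTop := areaIso.symm.tendsto_atTop

lemma tendsto_levelEnergy {m : ℝ} (hm : 0 < m) : Tendsto (levelEnergy m) atTop atTop :=
  Tendsto.const_mul_atTop hm
    (tendsto_invArea.comp (tendsto_id.atTop_div_const (sqrt_pos.2 hm)))

/-! ### The rearrangement of a steady state -/

lemma IsSteadyState.antitone {F : ℝ → ℝ} {eStar : WithTop ℝ} {m₀ : ℝ}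
    (h : IsSteadyState F eStar m₀) : Antitone F := by
  induction eStar using WithTop.recTopCoe with
  | top =>
    refine antitone_of_deriv_nonpos ?_ fun x => (h.deriv_neg x (WithTop.coe_lt_top x)).le
    have := h.contDiffOn
    simp only [WithTop.coe_lt_top, ofPred_true] at this
    exact (contDiffOn_univ.1 this).differentiable one_ne_zero
  | coe r =>
    have hset : {e : ℝ | (e : WithTop ℝ) < (r : WithTop ℝ)} = Iio r := by
      ext e; simp
    have h1 : AntitoneOn F (Iic r) := by
      refine antitoneOn_of_deriv_nonpos (convex_Iic r) h.continuous.continuousOn ?_ ?_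
      · rw [interior_Iic, ← hset]; exact h.contDiffOn.differentiableOn one_ne_zero
      · rw [interior_Iic]
        exact fun x hx => (h.deriv_neg x (WithTop.coe_lt_coe.2 hx)).le
    have h2 : AntitoneOn F (Ici r) := by
      intro a ha b hb _
      rw [h.eq_zero a (WithTop.coe_le_coe.2 ha), h.eq_zero b (WithTop.coe_le_coe.2 hb)]
    exact h1.Iic_union_Ici h2

lemma IsSteadyState.tendsto {F : ℝ → ℝ} {eStar : WithTop ℝ} {m₀ : ℝ}
    (h : IsSteadyState F eStar m₀) : Tendsto F atTop (𝓝 0) := by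
  induction eStar using WithTop.recTopCoe with
  | top => exact h.tendsto_zero rfl
  | coe r =>
    refine tendsto_const_nhds.congr' ?_
    filter_upwards [eventually_ge_atTop r] with e he
    exact (h.eq_zero e (WithTop.coe_le_coe.2 he)).symm

lemma IsSteadyState.nonneg {F : ℝ → ℝ} {eStar : WithTop ℝ} {m₀ : ℝ}
    (h : IsSteadyState F eStar m₀) (e : ℝ) : 0 ≤ F e :=
  h.antitone.le_of_tendsto h.tendsto e

lemma IsSteadyState.exists_countable {F : ℝ → ℝ} {eStar : WithTop ℝ} {m₀ : ℝ}
    (h : IsSteadyState F eStar m₀) :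
    ∃ S : Set ℝ, S.Countable ∧ ∀ e ∉ S, DifferentiableAt ℝ F e := by
  -- `deriv` is `0` where the derivative does not exist, so a negative value already implies
  -- differentiability.
  have key : ∀ e : ℝ, (e : WithTop ℝ) < eStar → DifferentiableAt ℝ F e := fun e he =>
    differentiableAt_of_deriv_ne_zero (h.deriv_neg e he).ne
  induction eStar using WithTop.recTopCoe with
  | top => exact ⟨∅, countable_empty, fun e _ => key e (WithTop.coe_lt_top e)⟩
  | coe r =>
    refine ⟨{r}, countable_singleton r, fun e he => ?_⟩
    rcases lt_or_gt_of_ne he with h1 | h1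
    · exact key e (WithTop.coe_lt_coe.2 h1)
    · refine (differentiableAt_const (0 : ℝ)).congr_of_eventuallyEq ?_
      filter_upwards [lt_mem_nhds h1] with x hx
      exact h.eq_zero x (WithTop.coe_le_coe.2 hx.le)

/-- The function `F ∘ a⁻¹`, where `a = a_{φ₀}` and `φ₀ = - m₀ cos`. -/
def profile (F : ℝ → ℝ) (m₀ s : ℝ) : ℝ := F (levelEnergy m₀ s)

/-- Let `η` be the energy whose sublevel set has area `s`. If `t ≥ F η`, then `{f₀ > t}` lies in
`{e₀ < η}`. If `t < F η`, continuity gives `b > η` with `F b > t`, so `{f₀ > t}` contains a sublevel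
set of area larger than `s`. The infimum is thus attained at `F η`. -/
lemma sharp_steady {F : ℝ → ℝ} {m₀ s : ℝ} (hm : 0 < m₀) (hF : Antitone F) (hc : Continuous F)
    (h0 : ∀ e, 0 ≤ F e) (hs : 0 ≤ s) : sharp (steady F m₀) s = profile F m₀ s := by
  set η := levelEnergy m₀ s with hη
  have hηm : -m₀ ≤ η := neg_le_levelEnergy hm hs
  have : {t : ℝ | 0 ≤ t ∧ distrib (steady F m₀) t ≤ ENNReal.ofReal s} = Ici (F η) := by
    ext t
    constructor
    · rintro ⟨ht, hd⟩
      by_contra hlt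
      rw [mem_Ici, not_le] at hlt
      obtain ⟨b, hb, hb'⟩ := ((hc.tendsto η).eventually (lt_mem_nhds hlt) |>.filter_mono
        (nhdsWithin_le_nhds (s := Ioi η)) |>.and self_mem_nhdsWithin).exists
      have hsub : {p | energy (cosPot m₀) p < b} ⊆ {p | t < steady F m₀ p} := fun p hp =>
        lt_of_lt_of_le hb (hF (le_of_lt hp))
      have h1 := (measure_mono hsub).trans hd
      rw [phase_sublevel_eq_area, ENNReal.ofReal_le_ofReal_iff hs,
        ← area_levelEnergy hm hs] at h1
      exact absurd h1 (not_le.2 ((area_lt_iff hηm (hηm.trans (le_of_lt hb'))).2 hb'))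
    · intro ht
      refine ⟨(h0 _).trans ht, ?_⟩
      have hsub : {p | t < steady F m₀ p} ⊆ {p | energy (cosPot m₀) p < η} := fun p hp => by
        by_contra hle
        exact absurd (lt_of_le_of_lt ht hp) (not_lt.2 (hF (not_lt.1 hle)))
      refine (measure_mono hsub).trans ?_
      rw [phase_sublevel_eq_area, area_levelEnergy hm hs]
  rw [sharp, this, csInf_Ici]; rfl

lemma profile_area_le {F : ℝ → ℝ} {m₀ : ℝ} (hm : 0 < m₀) (hF : Antitone F) {s e : ℝ}
    (hs : area (cosPot m₀) e ≤ s) (he : -m₀ ≤ e) : profile F m₀ s ≤ F e := by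
  rw [profile]
  refine hF ?_
  rw [← levelEnergy_area hm he]
  exact (strictMono_levelEnergy hm).monotone hs

/-! ### Domination of the rearrangements, uniformly for bounded `m` -/

lemma abs_energy_sub_le (m m' : ℝ) (p : ℝ × ℝ) :
    energy (cosPot m) p ≤ energy (cosPot m') p + |m - m'| := by
  rw [energy_cosPot, energy_cosPot]
  have h1 : |(m - m') * cos p.1| ≤ |m - m'| := by
    rw [abs_mul]; exact mul_le_of_le_one_right (abs_nonneg _) (abs_cos_le_one _)
  have := neg_abs_le ((m - m') * cos p.1)
  linarith

lemma area_le_area_add (m m' e : ℝ) :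
    area (cosPot m') e ≤ area (cosPot m) (e + |m - m'|) := by
  rw [area, area]
  refine ENNReal.toReal_mono ?_ (measure_mono fun p hp => ?_)
  · rw [phase_sublevel]; exact ENNReal.ofReal_ne_top
  · have := abs_energy_sub_le m m' p
    have hp' : energy (cosPot m') p < e := hp
    change energy (cosPot m) p < e + |m - m'|
    linarith

/-- What the proof uses of the decreasing rearrangement of the steady state: `Q` is its continuous
extension to the line. -/
structure IsProfile (Q : ℝ → ℝ) : Prop where
  continuous : Continuous Q
  antitone : Antitone Q
  tendsto_zero : Tendsto Q atTop (𝓝 0)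
  dominated : ∀ M : ℝ, ∃ D : ℝ × ℝ → ℝ, Integrable D phase ∧ ∀ m ∈ Icc 0 M, ∀ p : ℝ × ℝ,
    (1 + p.2 ^ 2) * Q (area (cosPot m) (energy (cosPot m) p)) ≤ D p

lemma measurePreserving_translate (a : ℝ) :
    MeasurePreserving (fun p : ℝ × ℝ => (p.1, p.2 + a)) phase phase :=
  (MeasurePreserving.id _).prod (measurePreserving_add_right volume a)

lemma integrable_strip (R C : ℝ) :
    Integrable (indicator {p : ℝ × ℝ | |p.2| < R} fun _ => C) phase := by
  have h1 : {p : ℝ × ℝ | |p.2| < R} = univ ×ˢ Ioo (-R) R := by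
    ext p; simp [abs_lt]
  rw [h1, integrable_indicator_iff (MeasurableSet.univ.prod measurableSet_Ioo)]
  refine integrableOn_const ?_
  rw [phase, Measure.prod_prod]
  simp only [Real.volume_Ioo, Measure.restrict_apply_univ, Real.volume_Icc]
  exact ENNReal.mul_ne_top ENNReal.ofReal_ne_top ENNReal.ofReal_ne_top

/-- Replacing `m` by `m₀` costs `|m₀ - m|` in the energy and again `|m₀ - m|` in the argument of the
area function. A drop `c` of kinetic energy pays for both. -/
lemma profile_le_translate {F : ℝ → ℝ} {m₀ m : ℝ} (hm₀ : 0 < m₀) (hF : Antitone F)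
    (p : ℝ × ℝ) {v c : ℝ} (hc : 2 * |m₀ - m| ≤ c) (hv : v ^ 2 / 2 + c ≤ p.2 ^ 2 / 2) :
    profile F m₀ (area (cosPot m) (energy (cosPot m) p)) ≤ steady F m₀ (p.1, v) := by
  refine profile_area_le hm₀ hF ?_ (neg_le_energy hm₀.le _)
  have h1 := abs_energy_sub_le m₀ m p
  have h2 : energy (cosPot m₀) (p.1, v) + c ≤ energy (cosPot m₀) p := by
    rw [energy_cosPot, energy_cosPot]; linarith
  refine (area_mono m₀ ?_).trans ((area_le_area_add m m₀ (energy (cosPot m) p - |m₀ - m|)).trans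
    (area_mono m ?_))
  · linarith
  · rw [abs_sub_comm m m₀]; linarith

lemma one_add_sq_le (u v : ℝ) (h : |u - v| ≤ 1) : 1 + u ^ 2 ≤ 3 * (1 + v ^ 2) := by
  have := abs_le.1 h
  nlinarith [sq_nonneg (u - 2 * v), sq_abs (u - v), abs_nonneg (u - v)]

/-- The dominating function is a constant on a strip `|v| < c + 1` plus a multiple of two velocity
translates of the integrable weight. Outside the strip, moving `v` by `1` towards zero lowers `v² /
2` by `|v| - 1/2 ≥ c`, which is what `profile_le_translate` requires; the two translates serve the
two signs of `v`. -/
lemma IsSteadyState.isProfile {F : ℝ → ℝ} {eStar : WithTop ℝ} {m₀ : ℝ}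
    (h : IsSteadyState F eStar m₀) : IsProfile (profile F m₀) where
  continuous := h.continuous.comp (continuous_levelEnergy m₀)
  antitone := h.antitone.comp_monotone (strictMono_levelEnergy h.m₀_pos).monotone
  tendsto_zero := h.tendsto.comp (tendsto_levelEnergy h.m₀_pos)
  dominated := by
    intro M
    set c := 2 * (M + m₀) with hc
    set f : ℝ × ℝ → ℝ := fun p => (1 + p.2 ^ 2) * steady F m₀ p with hf
    have hf0 : ∀ p, 0 ≤ f p := fun p => mul_nonneg (by positivity) (h.nonneg _)
    refine ⟨fun p => indicator {p : ℝ × ℝ | |p.2| < c + 1}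
      (fun _ => (1 + (c + 1) ^ 2) * profile F m₀ 0) p + 3 * (f (p.1, p.2 + -1) + f (p.1, p.2 + 1)),
      (integrable_strip _ _).add
        (((measurePreserving_translate (-1)).integrable_comp_of_integrable h.integrable).add
        ((measurePreserving_translate 1).integrable_comp_of_integrable h.integrable)
        |>.const_mul 3), ?_⟩
    rintro m ⟨hm, hmM⟩ p
    have hm₀ := h.m₀_pos
    have hd : 2 * |m₀ - m| ≤ c := by
      have : |m₀ - m| ≤ m₀ + m := abs_le.2 ⟨by linarith, by linarith⟩
      linarith
    have h1 := hf0 (p.1, p.2 + -1)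
    have h2 := hf0 (p.1, p.2 + 1)
    have key : ∀ v, |p.2 - v| ≤ 1 → v ^ 2 / 2 + c ≤ p.2 ^ 2 / 2 →
        (1 + p.2 ^ 2) * profile F m₀ (area (cosPot m) (energy (cosPot m) p)) ≤
          3 * f (p.1, v) := by
      intro v hv hv'
      have h3 := profile_le_translate hm₀ h.antitone p hd hv'
      have h4 := one_add_sq_le _ _ hv
      calc _ ≤ (3 * (1 + v ^ 2)) * steady F m₀ (p.1, v) :=
            mul_le_mul h4 h3 (h.nonneg _) (by positivity)
        _ = _ := by simp only [hf]; ring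
    have hc0 : 0 ≤ c := by linarith
    beta_reduce
    by_cases hp : |p.2| < c + 1
    · have h5 : p ∈ {p : ℝ × ℝ | |p.2| < c + 1} := hp
      rw [indicator_of_mem h5]
      have h6 : (1 + p.2 ^ 2) * profile F m₀ (area (cosPot m) (energy (cosPot m) p)) ≤
          (1 + (c + 1) ^ 2) * profile F m₀ 0 := by
        refine mul_le_mul ?_ ?_ (h.nonneg _) (by positivity)
        · have := sq_lt_sq' (abs_lt.1 hp).1 (abs_lt.1 hp).2; linarith
        · exact h.antitone ((strictMono_levelEnergy hm₀).monotone (area_nonneg _ _))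
      linarith
    · have h5 : p ∉ {p : ℝ × ℝ | |p.2| < c + 1} := hp
      rw [indicator_of_notMem h5, zero_add]
      rcases le_abs.1 (not_lt.1 hp) with h6 | h6
      · have := key (p.2 + -1) (by norm_num) (by nlinarith)
        linarith
      · have := key (p.2 + 1) (by norm_num) (by nlinarith)
        linarith

lemma IsSteadyState.rearr_eq {F : ℝ → ℝ} {eStar : WithTop ℝ} {m₀ : ℝ}
    (h : IsSteadyState F eStar m₀) (m : ℝ) (p : ℝ × ℝ) :
    rearr (steady F m₀) (cosPot m) p =
      profile F m₀ (area (cosPot m) (energy (cosPot m) p)) :=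
  sharp_steady h.m₀_pos h.antitone h.continuous h.nonneg (area_nonneg _ _)


/-! ### Layer-cake representation -/

section Layers

variable {Q : ℝ → ℝ}

lemma IsProfile.nonneg (h : IsProfile Q) (s : ℝ) : 0 ≤ Q s :=
  h.antitone.le_of_tendsto h.tendsto_zero s

/-- `-Q` as a Stieltjes function. -/
def IsProfile.stieltjes (h : IsProfile Q) : StieltjesFunction ℝ where
  toFun s := -Q s
  mono' := h.antitone.neg
  right_continuous' _ := h.continuous.neg.continuousWithinAt

/-- The measure `-dQ` on `(0, ∞)`. -/
def IsProfile.layers (h : IsProfile Q) : Measure ℝ := h.stieltjes.measure.restrict (Ioi 0)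

lemma IsProfile.layers_Ioi (h : IsProfile Q) {r : ℝ} (hr : 0 ≤ r) :
    h.layers (Ioi r) = ENNReal.ofReal (Q r) := by
  have ht : Tendsto h.stieltjes atTop (𝓝 0) := by
    have := h.tendsto_zero.neg
    rwa [neg_zero] at this
  rw [layers, Measure.restrict_apply measurableSet_Ioi, Ioi_inter_Ioi, sup_of_le_left hr,
    h.stieltjes.measure_Ioi ht]
  congr 1
  change 0 - -Q r = Q r
  ring

instance (h : IsProfile Q) : IsFiniteMeasure h.layers where
  measure_univ_lt_top := by
    have := h.layers_Ioi le_rfl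
    rw [IsProfile.layers, Measure.restrict_apply measurableSet_Ioi, inter_self] at this
    rw [IsProfile.layers, Measure.restrict_apply_univ, this]
    exact ENNReal.ofReal_lt_top

/-- Continuity of `Q` excludes atoms. This allows the one layer that sits on the separatrix for a
given `m` to be discarded. -/
lemma IsProfile.layers_singleton (h : IsProfile Q) (a : ℝ) : h.layers {a} = 0 := by
  refine le_antisymm ((Measure.restrict_apply_le _ _).trans ?_) zero_le
  have : Function.leftLim h.stieltjes a = h.stieltjes a :=
    (h.continuous.neg.continuousWithinAt (s := Iic a) (x := a)).leftLim_eq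
  rw [StieltjesFunction.measure_singleton, this, sub_self, ENNReal.ofReal_zero]

lemma IsProfile.ae_pos (h : IsProfile Q) : ∀ᵐ s ∂h.layers, 0 < s :=
  ae_restrict_mem measurableSet_Ioi

lemma IsProfile.ae_ne (h : IsProfile Q) (a : ℝ) : ∀ᵐ s ∂h.layers, s ≠ a := by
  rw [ae_iff]; simpa using h.layers_singleton a

lemma IsProfile.integral_indicator_Ioi (h : IsProfile Q) {r : ℝ} (hr : 0 ≤ r) (c : ℝ) :
    ∫ s, indicator (Ioi r) (fun _ => c) s ∂h.layers = c * Q r := by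
  rw [integral_indicator measurableSet_Ioi, setIntegral_const, measureReal_def, h.layers_Ioi hr,
    ENNReal.toReal_ofReal (h.nonneg r), smul_eq_mul, mul_comm]

lemma IsProfile.integrable_layer (h : IsProfile Q) {g B : ℝ × ℝ → ℝ} (hg : Measurable g)
    (hB : Measurable B) (hB0 : ∀ p, 0 ≤ B p) (hi : Integrable (fun p => g p * Q (B p)) phase) :
    Integrable (fun q : (ℝ × ℝ) × ℝ => indicator {q : (ℝ × ℝ) × ℝ | B q.1 < q.2}
      (fun q => g q.1) q) (phase.prod h.layers) := by
  have hms : MeasurableSet {q : (ℝ × ℝ) × ℝ | B q.1 < q.2} :=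
    measurableSet_lt (hB.comp measurable_fst) measurable_snd
  have hslice : ∀ p s, indicator {q : (ℝ × ℝ) × ℝ | B q.1 < q.2} (fun q => g q.1) (p, s) =
      indicator (Ioi (B p)) (fun _ => g p) s := fun p s => by simp [indicator]
  have hmeas : Measurable (indicator {q : (ℝ × ℝ) × ℝ | B q.1 < q.2} fun q => g q.1) :=
    (hg.comp measurable_fst).indicator hms
  rw [integrable_prod_iff hmeas.aestronglyMeasurable]
  constructor
  · refine Eventually.of_forall fun p => ?_
    simp only [hslice]
    exact (integrable_const _).indicator measurableSet_Ioi
  · refine hi.norm.congr (Eventually.of_forall fun p => ?_)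
    have : ∀ s, ‖indicator (Ioi (B p)) (fun _ => g p) s‖ =
        indicator (Ioi (B p)) (fun _ => ‖g p‖) s := fun s => norm_indicator_eq_indicator_norm _ _
    simp only [hslice, this, h.integral_indicator_Ioi (hB0 p), norm_mul,
      Real.norm_of_nonneg (h.nonneg _)]

/-- Fubini for `g(p)` on the set `B p < s`: integrating over `s` first produces the mass `Q (B p)`
of the layers beyond `B p`, integrating over `p` first produces the sublevel sets of `B`. -/
lemma IsProfile.integral_eq_layers (h : IsProfile Q) {g B : ℝ × ℝ → ℝ} (hg : Measurable g)
    (hB : Measurable B) (hB0 : ∀ p, 0 ≤ B p) (hi : Integrable (fun p => g p * Q (B p)) phase) :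
    Integrable (fun s => ∫ p in {p | B p < s}, g p ∂phase) h.layers ∧
    ∫ p, g p * Q (B p) ∂phase = ∫ s, (∫ p in {p | B p < s}, g p ∂phase) ∂h.layers := by
  have hI := h.integrable_layer hg hB hB0 hi
  have h1 : ∀ s, ∫ p in {p | B p < s}, g p ∂phase =
      ∫ p, indicator {q : (ℝ × ℝ) × ℝ | B q.1 < q.2} (fun q => g q.1) (p, s) ∂phase := by
    intro s
    rw [← integral_indicator (measurableSet_lt hB measurable_const)]
    rfl
  simp only [h1]
  refine ⟨hI.integral_prod_right, ?_⟩
  rw [← integral_integral_swap (f := fun p s => indicator {q : (ℝ × ℝ) × ℝ | B q.1 < q.2}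
      (fun q => g q.1) (p, s)) hI]
  refine integral_congr_ae (Eventually.of_forall fun p => ?_)
  exact (h.integral_indicator_Ioi (hB0 p) (g p)).symm

/-! ### First derivative -/

/-- `Q(a_φ(e(θ, v)))` for `φ = - m cos`. -/
def layered (Q : ℝ → ℝ) (m : ℝ) (p : ℝ × ℝ) : ℝ := Q (area (cosPot m) (energy (cosPot m) p))

lemma continuous_area_energy :
    Continuous fun q : ℝ × (ℝ × ℝ) => area (cosPot q.1) (energy (cosPot q.1) q.2) :=
  continuous_area.comp (continuous_fst.prodMk continuous_energy_cosPot)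

lemma continuous_area_energy_right (m : ℝ) :
    Continuous fun p : ℝ × ℝ => area (cosPot m) (energy (cosPot m) p) :=
  (continuous_area_right m).comp (continuous_energy m)

lemma IsProfile.layered_nonneg (h : IsProfile Q) (m : ℝ) (p : ℝ × ℝ) : 0 ≤ layered Q m p :=
  h.nonneg _

lemma IsProfile.continuous_layered (h : IsProfile Q) (m : ℝ) : Continuous (layered Q m) :=
  h.continuous.comp (continuous_area_energy_right m)

lemma IsProfile.integrable_mul_layered (h : IsProfile Q) {m : ℝ} (hm : 0 ≤ m) {g : ℝ × ℝ → ℝ}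
    (hg : Continuous g) {C : ℝ} (hC : ∀ p, |g p| ≤ C * (1 + p.2 ^ 2)) :
    Integrable (fun p => g p * layered Q m p) phase := by
  obtain ⟨D, hD, hle⟩ := h.dominated m
  refine (hD.const_mul C).mono' (hg.mul (h.continuous_layered m)).aestronglyMeasurable
    (Eventually.of_forall fun p => ?_)
  have hC0 : 0 ≤ C := by
    have := (abs_nonneg _).trans (hC 0)
    simpa using this
  rw [norm_mul, Real.norm_of_nonneg (h.layered_nonneg m p), Real.norm_eq_abs]
  calc |g p| * layered Q m p ≤ C * (1 + p.2 ^ 2) * layered Q m p :=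
        mul_le_mul_of_nonneg_right (hC p) (h.nonneg _)
    _ = C * ((1 + p.2 ^ 2) * layered Q m p) := by ring
    _ ≤ C * D p := mul_le_mul_of_nonneg_left (hle m ⟨hm, le_rfl⟩ p) hC0

lemma abs_cos_fst_le (p : ℝ × ℝ) : |cos p.1| ≤ 1 * (1 + p.2 ^ 2) := by
  nlinarith [abs_cos_le_one p.1, sq_nonneg p.2]

lemma abs_energy_le (m : ℝ) (p : ℝ × ℝ) :
    |energy (cosPot m) p| ≤ (1 + |m|) * (1 + p.2 ^ 2) := by
  rw [energy_cosPot]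
  have h1 : |m * cos p.1| ≤ |m| := by
    rw [abs_mul]; exact mul_le_of_le_one_right (abs_nonneg _) (abs_cos_le_one _)
  have h2 := abs_nonneg m
  have h3 := sq_nonneg p.2
  have h4 := mul_nonneg h2 h3
  calc |p.2 ^ 2 / 2 - m * cos p.1| ≤ |p.2 ^ 2 / 2| + |m * cos p.1| := abs_sub _ _
    _ ≤ p.2 ^ 2 / 2 + |m| := by rw [abs_of_nonneg (by positivity)]; linarith
    _ ≤ _ := by nlinarith

lemma IsProfile.integrable_energy_mul (h : IsProfile Q) {m : ℝ} (hm : 0 ≤ m) (m' : ℝ) :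
    Integrable (fun p => energy (cosPot m') p * layered Q m p) phase :=
  h.integrable_mul_layered hm (continuous_energy m') (abs_energy_le m')

lemma IsProfile.integrable_cos_mul (h : IsProfile Q) {m : ℝ} (hm : 0 ≤ m) :
    Integrable (fun p => cos p.1 * layered Q m p) phase :=
  h.integrable_mul_layered hm (by fun_prop) abs_cos_fst_le

/-- `∬ e f^{*φ}` for `φ = - m cos`. -/
def meanEnergy (Q : ℝ → ℝ) (m : ℝ) : ℝ := ∫ p, energy (cosPot m) p * layered Q m p ∂phase

/-- `∬ cos θ f^{*φ}` for `φ = - m cos`. -/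
def magnetization (Q : ℝ → ℝ) (m : ℝ) : ℝ := ∫ p, cos p.1 * layered Q m p ∂phase

lemma integrableOn_energy (m m' E : ℝ) :
    IntegrableOn (energy (cosPot m')) {p | energy (cosPot m) p < E} phase := by
  have hfin : phase {p | energy (cosPot m) p < E} ≠ ⊤ := by
    rw [phase_sublevel]; exact ENNReal.ofReal_ne_top
  refine Measure.integrableOn_of_bounded hfin (continuous_energy m').aestronglyMeasurable
    (M := |E| + |m' - m| + |m'|) ?_
  filter_upwards [ae_restrict_mem (measurableSet_sublevel m E)] with p hp
  have hp' : energy (cosPot m) p < E := hp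
  have h1 := abs_energy_sub_le m' m p
  have h2 := energy_cosPot m' p
  have h3 : |m' * cos p.1| ≤ |m'| := by
    rw [abs_mul]; exact mul_le_of_le_one_right (abs_nonneg _) (abs_cos_le_one _)
  have h4 := abs_le.1 h3
  rw [Real.norm_eq_abs, abs_le]
  constructor
  · have := abs_nonneg E; have := abs_nonneg (m' - m); have := sq_nonneg p.2
    linarith
  · have := le_abs_self E; have := abs_nonneg m'
    linarith

/-- Sublevel sets of the energy minimise the total energy at given measure. -/
lemma setIntegral_energy_le {m m' s : ℝ} (hm : 0 ≤ m) (hm' : 0 ≤ m') (hs : 0 ≤ s) :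
    ∫ p in {p | area (cosPot m') (energy (cosPot m') p) < s}, energy (cosPot m') p ∂phase ≤
      ∫ p in {p | area (cosPot m) (energy (cosPot m) p) < s}, energy (cosPot m') p ∂phase := by
  obtain ⟨E, hE, hEs⟩ := exists_area_eq hm hs
  obtain ⟨E', hE', hEs'⟩ := exists_area_eq hm' hs
  have h1 : {p | area (cosPot m) (energy (cosPot m) p) < s} = {p | energy (cosPot m) p < E} := by
    rw [← hEs]; exact setOf_area_lt hm hE
  have h2 : {p | area (cosPot m') (energy (cosPot m') p) < s} =
      {p | energy (cosPot m') p < E'} := by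
    rw [← hEs']; exact setOf_area_lt hm' hE'
  rw [h1, h2]
  have hvol : ∀ n A, area (cosPot n) A = s → phase {p | energy (cosPot n) p < A} =
      ENNReal.ofReal s := fun n A hA => by rw [phase_sublevel_eq_area, hA]
  have hfin : ∀ n A, IntegrableOn (fun _ : ℝ × ℝ => E') {p | energy (cosPot n) p < A} phase :=
    fun n A => integrableOn_const (by rw [phase_sublevel]; exact ENNReal.ofReal_ne_top)
  have hconst : ∀ n A, area (cosPot n) A = s →
      ∫ p in {p | energy (cosPot n) p < A}, (energy (cosPot m') p - E') ∂phase =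
      ∫ p in {p | energy (cosPot n) p < A}, energy (cosPot m') p ∂phase - s * E' := by
    intro n A hA
    rw [integral_sub (integrableOn_energy n m' A) (hfin n A), setIntegral_const,
      measureReal_def, hvol n A hA, ENNReal.toReal_ofReal hs, smul_eq_mul]
  -- Bathtub principle: `e_{m'} - E'` is negative exactly on the sublevel set for `m'`, so that set
  -- minimises its integral among all sets. Both sets have measure `s`, so the constant `E'`
  -- contributes equally to the two sides.
  have key : ∫ p in {p | energy (cosPot m') p < E'}, (energy (cosPot m') p - E') ∂phase ≤
      ∫ p in {p | energy (cosPot m) p < E}, (energy (cosPot m') p - E') ∂phase := by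
    have hi : ∀ n A, IntegrableOn (fun p => energy (cosPot m') p - E')
        {p | energy (cosPot n) p < A} phase := fun n A =>
      (integrableOn_energy n m' A).sub (hfin n A)
    rw [← integral_indicator (measurableSet_sublevel _ _),
      ← integral_indicator (measurableSet_sublevel _ _)]
    refine integral_mono ((hi _ _).integrable_indicator (measurableSet_sublevel _ _))
      ((hi _ _).integrable_indicator (measurableSet_sublevel _ _)) fun p => ?_
    by_cases hp : energy (cosPot m') p < E'
    · rw [indicator_of_mem (show p ∈ {p | energy (cosPot m') p < E'} from hp)]
      by_cases hq : p ∈ {p | energy (cosPot m) p < E}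
      · rw [indicator_of_mem hq]
      · rw [indicator_of_notMem hq]; linarith
    · rw [indicator_of_notMem (show p ∉ {p | energy (cosPot m') p < E'} from hp)]
      exact indicator_apply_nonneg fun _ => by linarith
  rw [hconst m E hEs, hconst m' E' hEs'] at key
  linarith

/-- The rearrangement for `m` is a competitor in the minimisation for `m'`, layer by layer, and its
energy is affine in `m'`. -/
lemma IsProfile.meanEnergy_le (h : IsProfile Q) {m m' : ℝ} (hm : 0 ≤ m) (hm' : 0 ≤ m') :
    meanEnergy Q m' ≤ meanEnergy Q m + (m' - m) * -magnetization Q m := by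
  have hmeas := fun n => (continuous_area_energy_right n).measurable
  have h1 := h.integral_eq_layers (continuous_energy m').measurable (hmeas m')
    (fun p => area_nonneg _ _) (h.integrable_energy_mul hm' m')
  have h2 := h.integral_eq_layers (continuous_energy m').measurable (hmeas m)
    (fun p => area_nonneg _ _) (h.integrable_energy_mul hm m')
  have h3 : meanEnergy Q m' ≤ ∫ p, energy (cosPot m') p * layered Q m p ∂phase := by
    rw [meanEnergy]
    simp only [layered]
    rw [h1.2, h2.2]
    refine integral_mono_ae h1.1 h2.1 ?_
    filter_upwards [h.ae_pos] with s hs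
    exact setIntegral_energy_le hm hm' hs.le
  refine h3.trans_eq ?_
  rw [meanEnergy, magnetization, mul_neg, ← sub_eq_add_neg, ← integral_const_mul,
    ← integral_sub (h.integrable_energy_mul hm m) ((h.integrable_cos_mul hm).const_mul _)]
  refine integral_congr_ae (Eventually.of_forall fun p => ?_)
  simp only [energy_cosPot]; ring

lemma IsProfile.continuousOn_magnetization (h : IsProfile Q) :
    ContinuousOn (magnetization Q) (Ici 0) := by
  intro m₁ _
  obtain ⟨D, hD, hle⟩ := h.dominated (m₁ + 1)
  refine continuousWithinAt_of_dominated (bound := D) ?_ ?_ hD ?_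
  · exact Eventually.of_forall fun m => (Continuous.mul (by fun_prop)
      (h.continuous_layered m)).aestronglyMeasurable
  · have : Iio (m₁ + 1) ∈ 𝓝[Ici 0] m₁ := nhdsWithin_le_nhds (Iio_mem_nhds (lt_add_one m₁))
    filter_upwards [this, self_mem_nhdsWithin] with m hm hm0
    refine Eventually.of_forall fun p => le_trans ?_ (hle m ⟨hm0, le_of_lt hm⟩ p)
    rw [norm_mul, Real.norm_of_nonneg (h.layered_nonneg m p), Real.norm_eq_abs]
    refine mul_le_mul_of_nonneg_right ?_ (h.nonneg _)
    simpa using abs_cos_fst_le p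
  · refine Eventually.of_forall fun p => Continuous.continuousWithinAt ?_
    refine continuous_const.mul (h.continuous.comp ?_)
    exact continuous_area_energy.comp (by fun_prop : Continuous fun m : ℝ => (m, p))

/-- A function with continuous supporting slopes is differentiable. -/
lemma hasDerivWithinAt_of_supporting {h k : ℝ → ℝ} {s : Set ℝ} {x : ℝ}
    (hsup : ∀ a ∈ s, ∀ b ∈ s, h b ≤ h a + (b - a) * k a) (hx : x ∈ s)
    (hk : ContinuousWithinAt k s x) : HasDerivWithinAt h (k x) s x := by
  rw [hasDerivWithinAt_iff_isLittleO, Asymptotics.isLittleO_iff]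
  intro c hc
  have hev : ∀ᶠ y in 𝓝[s] x, |k y - k x| < c := by
    have := (Metric.tendsto_nhds.1 hk c hc)
    simpa [Real.dist_eq] using this
  filter_upwards [hev, self_mem_nhdsWithin] with y hy hys
  -- The supporting inequalities at `x` and at `y` trap `h y - h x` between `(y - x) k y` and `(y -
  -- x) k x`.
  have h1 := hsup x hx y hys
  have h2 := hsup y hys x hx
  have h3 : |h y - h x - (y - x) * k x| ≤ |(k y - k x) * (y - x)| := by
    rw [abs_le]
    have := neg_abs_le ((k y - k x) * (y - x))
    have := abs_nonneg ((k y - k x) * (y - x))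
    exact ⟨by linarith, by nlinarith⟩
  rw [smul_eq_mul, Real.norm_eq_abs, Real.norm_eq_abs]
  refine h3.trans ?_
  rw [abs_mul]
  exact mul_le_mul_of_nonneg_right hy.le (abs_nonneg _)

lemma IsProfile.hasDerivWithinAt_meanEnergy (h : IsProfile Q) {m : ℝ} (hm : 0 ≤ m) :
    HasDerivWithinAt (meanEnergy Q) (-magnetization Q m) (Ici 0) m :=
  hasDerivWithinAt_of_supporting (k := fun m => -magnetization Q m)
    (fun _ ha _ hb => h.meanEnergy_le ha hb) hm (h.continuousOn_magnetization m hm).neg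

end Layers


/-! ### Integrals over the orbits of given energy -/

/-- The derivative `∫ w(θ) √2 (e + m cos θ)^{-1/2} dθ` of `slab w m`. -/
def orbitInt (w : ℝ → ℝ) (m e : ℝ) : ℝ :=
  ∫ θ in (0 : ℝ)..(2 * π), w θ * (√2 / √(e + m * cos θ))

lemma monotone_two_sqrt (c : ℝ) : Monotone fun t : ℝ => 2 * √(2 * (t + c)) := fun a b hab =>
  mul_le_mul_of_nonneg_left (sqrt_le_sqrt (by linarith)) two_pos.le

lemma hasDerivAt_two_sqrt {c t : ℝ} (h : t ≠ -c) :
    HasDerivAt (fun t : ℝ => 2 * √(2 * (t + c))) (√2 / √(t + c)) t := by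
  rcases lt_or_gt_of_ne h with h | h
  · have h0 : √(t + c) = 0 := sqrt_eq_zero_of_nonpos (by linarith)
    rw [h0, div_zero]
    refine (hasDerivAt_const t (0 : ℝ)).congr_of_eventuallyEq ?_
    filter_upwards [Iio_mem_nhds h] with y hy
    rw [mem_Iio] at hy
    rw [sqrt_eq_zero_of_nonpos (by linarith), mul_zero]
  · have hpos : 0 < t + c := by linarith
    have h1 : HasDerivAt (fun t : ℝ => 2 * (t + c)) 2 t := by
      simpa using ((hasDerivAt_id t).add_const c).const_mul 2
    refine ((h1.sqrt (by positivity)).const_mul 2).congr_deriv ?_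
    rw [sqrt_mul two_pos.le]
    have := sqrt_pos.2 hpos
    have h2 : √2 * √2 = 2 := mul_self_sqrt two_pos.le
    have := sqrt_pos.2 (two_pos (α := ℝ))
    field_simp
    nlinarith

/-- The singular integrand is almost everywhere the derivative of a monotone function, hence
integrable. -/
lemma intervalIntegrable_inv_sqrt (c a b : ℝ) :
    IntervalIntegrable (fun t => √2 / √(t + c)) volume a b := by
  have h := ((monotone_two_sqrt c).monotoneOn (uIcc a b)).intervalIntegrable_deriv
  refine h.congr_ae ?_
  have : ∀ᵐ t : ℝ ∂volume.restrict (uIoc a b), t ≠ -c :=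
    ae_restrict_of_ae (by simp [ae_iff])
  filter_upwards [this] with t ht
  exact (hasDerivAt_two_sqrt ht).deriv

lemma integral_inv_sqrt (c a b : ℝ) :
    ∫ t in a..b, √2 / √(t + c) = 2 * √(2 * (b + c)) - 2 * √(2 * (a + c)) :=
  integral_eq_of_hasDerivAt_off_countable _ _ (countable_singleton (-c))
    (Continuous.continuousOn (by fun_prop)) (fun _ ht => hasDerivAt_two_sqrt ht.2)
    (intervalIntegrable_inv_sqrt c a b)

lemma measurable_inv_sqrt (m : ℝ) :
    Measurable fun q : ℝ × ℝ => √2 / √(q.2 + m * cos q.1) :=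
  Measurable.div measurable_const (Continuous.measurable (by fun_prop))

/-- At fixed angle the energy integral has an explicit primitive, continuous in the angle.
Integrating in this order avoids the orbit integral at the separatrix, which diverges for `w = 1`.
-/
lemma integrable_orbit_prod {w : ℝ → ℝ} (hw : Continuous w) (hb : ∀ θ, |w θ| ≤ 1) (m : ℝ)
    {a b : ℝ} (hab : a ≤ b) :
    Integrable (fun q : ℝ × ℝ => w q.1 * (√2 / √(q.2 + m * cos q.1)))
      ((volume.restrict (Icc 0 (2 * π))).prod (volume.restrict (Ioc a b))) := by
  have h1 : Integrable (fun q : ℝ × ℝ => √2 / √(q.2 + m * cos q.1))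
      ((volume.restrict (Icc 0 (2 * π))).prod (volume.restrict (Ioc a b))) := by
    rw [integrable_prod_iff (measurable_inv_sqrt m).aestronglyMeasurable]
    have hi : ∀ θ, IntegrableOn (fun t => √2 / √(t + m * cos θ)) (Ioc a b) := fun θ =>
      (intervalIntegrable_iff_integrableOn_Ioc_of_le hab).1 (intervalIntegrable_inv_sqrt _ _ _)
    refine ⟨Eventually.of_forall hi, ?_⟩
    have : ∀ θ, ∫ t in Ioc a b, ‖√2 / √(t + m * cos θ)‖ =
        2 * √(2 * (b + m * cos θ)) - 2 * √(2 * (a + m * cos θ)) := by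
      intro θ
      rw [← integral_inv_sqrt, intervalIntegral.integral_of_le hab]
      refine integral_congr_ae (Eventually.of_forall fun t => ?_)
      exact Real.norm_of_nonneg (by positivity)
    simp only [this]
    exact Continuous.integrableOn_Icc (by fun_prop)
  refine h1.norm.mono' (hw.measurable.comp measurable_fst |>.mul
    (measurable_inv_sqrt m)).aestronglyMeasurable (Eventually.of_forall fun q => ?_)
  rw [norm_mul]
  exact mul_le_of_le_one_left (norm_nonneg _) (hb q.1)

lemma orbitInt_eq_setIntegral (w : ℝ → ℝ) (m e : ℝ) :
    orbitInt w m e = ∫ θ in Icc 0 (2 * π), w θ * (√2 / √(e + m * cos θ)) := by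
  rw [orbitInt, intervalIntegral.integral_of_le two_pi_nonneg, integral_Icc_eq_integral_Ioc]

lemma intervalIntegrable_orbitInt {w : ℝ → ℝ} (hw : Continuous w) (hb : ∀ θ, |w θ| ≤ 1) (m : ℝ)
    (a b : ℝ) : IntervalIntegrable (orbitInt w m) volume a b := by
  have key : ∀ a b : ℝ, a ≤ b → IntervalIntegrable (orbitInt w m) volume a b := by
    intro a b hab
    rw [intervalIntegrable_iff_integrableOn_Ioc_of_le hab]
    have := (integrable_orbit_prod hw hb m hab).integral_prod_right
    exact this.congr (Eventually.of_forall fun t => (orbitInt_eq_setIntegral w m t).symm)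
  rcases le_total a b with h | h
  · exact key a b h
  · exact (key b a h).symm

lemma slab_sub {w : ℝ → ℝ} (hw : Continuous w) (hb : ∀ θ, |w θ| ≤ 1) (m : ℝ) {a b : ℝ}
    (hab : a ≤ b) : slab w m b - slab w m a = ∫ t in a..b, orbitInt w m t := by
  have hswap := integral_integral_swap (f := fun θ t => w θ * (√2 / √(t + m * cos θ)))
    (integrable_orbit_prod hw hb m hab)
  rw [intervalIntegral.integral_of_le hab]
  simp only [orbitInt_eq_setIntegral]
  rw [← hswap, slab_eq_setIntegral, slab_eq_setIntegral, ← integral_sub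
    (Continuous.integrableOn_Icc (by fun_prop)) (Continuous.integrableOn_Icc (by fun_prop))]
  refine integral_congr_ae (Eventually.of_forall fun θ => ?_)
  simp only
  rw [integral_const_mul, ← intervalIntegral.integral_of_le hab, integral_inv_sqrt]
  ring

lemma stronglyMeasurable_orbitInt {w : ℝ → ℝ} (hw : Continuous w) (m : ℝ) :
    StronglyMeasurable (orbitInt w m) := by
  have h : orbitInt w m = fun t => ∫ θ in Icc 0 (2 * π), w θ * (√2 / √(t + m * cos θ)) :=
    funext (orbitInt_eq_setIntegral w m)
  rw [h]
  refine StronglyMeasurable.integral_prod_right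
    (f := fun t θ => w θ * (√2 / √(t + m * cos θ))) (Measurable.stronglyMeasurable ?_)
  exact (hw.measurable.comp measurable_snd).mul
    ((measurable_inv_sqrt m).comp measurable_swap)

lemma hasDerivAt_slab {w : ℝ → ℝ} (hw : Continuous w) (hb : ∀ θ, |w θ| ≤ 1) {m x : ℝ}
    (hc : ContinuousAt (orbitInt w m) x) : HasDerivAt (slab w m) (orbitInt w m x) x := by
  have h1 := intervalIntegral.integral_hasDerivAt_right
    (intervalIntegrable_orbitInt hw hb m (x - 1) x)
    (stronglyMeasurable_orbitInt hw m).stronglyMeasurableAtFilter hc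
  refine (h1.const_add (slab w m (x - 1))).congr_of_eventuallyEq ?_
  filter_upwards [Ioi_mem_nhds (show x - 1 < x by linarith)] with y hy
  rw [← slab_sub hw hb m (le_of_lt hy)]; ring

lemma orbitInt_scaling (w : ℝ → ℝ) {m : ℝ} (hm : 0 < m) (e : ℝ) :
    orbitInt w m e = (√m)⁻¹ * orbitInt w 1 (e / m) := by
  rw [orbitInt, orbitInt, ← intervalIntegral.integral_const_mul]
  refine intervalIntegral.integral_congr fun θ _ => ?_
  have : e + m * cos θ = m * (e / m + 1 * cos θ) := by field_simp
  simp only [this]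
  rw [sqrt_mul hm.le, div_mul_eq_div_div_swap, div_eq_mul_inv _ (√m)]; ring

/-! #### Energies below the separatrix -/

/-- The substitution `θ = arccos (1 - (1 + x) sin² ψ)` that resolves the turning point. -/
def orbitAngle (x ψ : ℝ) : ℝ := arccos (1 - (1 + x) * sin ψ ^ 2)

lemma sin_sq_mem {ψ : ℝ} (hψ : ψ ∈ Ioo 0 (π / 2)) : 0 < sin ψ ^ 2 ∧ sin ψ ^ 2 < 1 := by
  have h1 : 0 < sin ψ := sin_pos_of_pos_of_lt_pi hψ.1 (by linarith [hψ.2, pi_pos])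
  have h2 : 0 < cos ψ := cos_pos_of_mem_Ioo ⟨by linarith [hψ.1, pi_pos], hψ.2⟩
  exact ⟨by positivity, by nlinarith [sin_sq_add_cos_sq ψ]⟩

lemma hasDerivAt_orbitAngle {x ψ : ℝ} (h1 : -1 < x) (h2 : x < 1) (hψ : ψ ∈ Ioo 0 (π / 2)) :
    HasDerivAt (orbitAngle x) (2 * √(1 + x) * cos ψ / √(2 - (1 + x) * sin ψ ^ 2)) ψ := by
  obtain ⟨hs1, hs2⟩ := sin_sq_mem hψ
  have hs : 0 < sin ψ := sin_pos_of_pos_of_lt_pi hψ.1 (by linarith [hψ.2, pi_pos])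
  have hx : 0 < 1 + x := by linarith
  have hA : 0 < 2 - (1 + x) * sin ψ ^ 2 := by nlinarith
  have hB : 0 < (1 + x) * sin ψ ^ 2 := by positivity
  have hd : HasDerivAt (fun ψ => 1 - (1 + x) * sin ψ ^ 2)
      (-((1 + x) * (2 * sin ψ * cos ψ))) ψ := by
    simpa using (((hasDerivAt_sin ψ).pow 2).const_mul (1 + x)).const_sub 1
  have h := (hasDerivAt_arccos (x := 1 - (1 + x) * sin ψ ^ 2) (by nlinarith)
    (by nlinarith)).comp ψ hd
  refine h.congr_deriv ?_
  have h3 : 1 - (1 - (1 + x) * sin ψ ^ 2) ^ 2 =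
      ((1 + x) * sin ψ ^ 2) * (2 - (1 + x) * sin ψ ^ 2) := by ring
  rw [h3, sqrt_mul hB.le, sqrt_mul hx.le, sqrt_sq hs.le]
  have h4 := sqrt_pos.2 hx
  have h5 := sqrt_pos.2 hA
  have h6 : √(1 + x) * √(1 + x) = 1 + x := mul_self_sqrt hx.le
  field_simp
  rw [sq, h6]

lemma cos_orbitAngle {x ψ : ℝ} (h1 : -1 < x) (h2 : x < 1) :
    cos (orbitAngle x ψ) = 1 - (1 + x) * sin ψ ^ 2 := by
  have := sin_sq_le_one ψ
  have := sq_nonneg (sin ψ)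
  exact cos_arccos (by nlinarith) (by nlinarith)

lemma injOn_orbitAngle {x : ℝ} (h1 : -1 < x) (h2 : x < 1) :
    InjOn (orbitAngle x) (Ioo 0 (π / 2)) := by
  intro a ha b hb hab
  have h := congrArg cos hab
  rw [cos_orbitAngle h1 h2, cos_orbitAngle h1 h2] at h
  have hsa : 0 < sin a := sin_pos_of_pos_of_lt_pi ha.1 (by linarith [ha.2, pi_pos])
  have hsb : 0 < sin b := sin_pos_of_pos_of_lt_pi hb.1 (by linarith [hb.2, pi_pos])
  have h3 : sin a ^ 2 = sin b ^ 2 := by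
    have : (1 + x) * sin a ^ 2 = (1 + x) * sin b ^ 2 := by linarith
    exact mul_left_cancel₀ (by linarith) this
  have h4 : sin a = sin b := by
    rwa [sq_eq_sq₀ hsa.le hsb.le] at h3
  exact injOn_sin ⟨by linarith [ha.1, pi_pos], ha.2.le⟩ ⟨by linarith [hb.1, pi_pos], hb.2.le⟩ h4

lemma image_orbitAngle {x : ℝ} (h1 : -1 < x) (h2 : x < 1) :
    orbitAngle x '' Ioo 0 (π / 2) = Ioo 0 (arccos (-x)) := by
  ext θ
  constructor
  · rintro ⟨ψ, hψ, rfl⟩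
    obtain ⟨hs1, hs2⟩ := sin_sq_mem hψ
    refine ⟨arccos_pos.2 (by nlinarith), ?_⟩
    exact strictAntiOn_arccos ⟨by linarith, by linarith⟩ ⟨by nlinarith, by nlinarith⟩
      (by nlinarith)
  · rintro ⟨hθ1, hθ2⟩
    have hθ3 : θ < π := hθ2.trans_le (arccos_le_pi _)
    have hc1 : cos θ < 1 := by
      rw [← cos_zero]; exact strictAntiOn_cos ⟨le_rfl, pi_pos.le⟩ ⟨hθ1.le, hθ3.le⟩ hθ1
    have hc2 : -x < cos θ := by
      rw [← cos_arccos (x := -x) (by linarith) (by linarith)]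
      exact strictAntiOn_cos ⟨hθ1.le, hθ3.le⟩ ⟨arccos_nonneg _, arccos_le_pi _⟩ hθ2
    have hx : 0 < 1 + x := by linarith
    set u := (1 - cos θ) / (1 + x) with hu
    have hu0 : 0 < u := div_pos (by linarith) hx
    have hu1 : u < 1 := by rw [hu, div_lt_one hx]; linarith
    have hsu0 := sqrt_pos.2 hu0
    have hsu1 : √u < 1 := by rw [sqrt_lt' one_pos]; linarith
    refine ⟨arcsin √u, ⟨arcsin_pos.2 hsu0, arcsin_lt_pi_div_two.2 hsu1⟩, ?_⟩
    rw [orbitAngle, sin_arcsin (by linarith) hsu1.le, sq_sqrt hu0.le, hu,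
      mul_div_cancel₀ _ hx.ne', sub_sub_cancel, arccos_cos hθ1.le hθ3.le]


/-- The integrand of an orbit integral after the substitution `orbitAngle`. -/
def orbitIntegrand (g : ℝ → ℝ) (x ψ : ℝ) : ℝ :=
  g (1 - (1 + x) * sin ψ ^ 2) * (2 * √2 / √(2 - (1 + x) * sin ψ ^ 2))

/-- Along the substitution `x + cos θ = (1 + x) cos² ψ`, so the factor `cos ψ` of the Jacobian
cancels the turning-point singularity. The remaining root is bounded away from zero because `x < 1`.
-/
lemma orbitAngle_smul (g : ℝ → ℝ) {x ψ : ℝ} (h1 : -1 < x) (h2 : x < 1)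
    (hψ : ψ ∈ Ioo 0 (π / 2)) :
    |2 * √(1 + x) * cos ψ / √(2 - (1 + x) * sin ψ ^ 2)| •
      (g (cos (orbitAngle x ψ)) * (√2 / √(x + 1 * cos (orbitAngle x ψ)))) =
        orbitIntegrand g x ψ := by
  have hc : 0 < cos ψ := cos_pos_of_mem_Ioo ⟨by linarith [hψ.1, pi_pos], hψ.2⟩
  have hx : 0 < 1 + x := by linarith
  have h4 := sqrt_pos.2 hx
  have h6 : x + 1 * (1 - (1 + x) * sin ψ ^ 2) = (1 + x) * cos ψ ^ 2 := by
    rw [cos_sq']; ring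
  rw [abs_of_nonneg (by positivity), cos_orbitAngle h1 h2, h6, sqrt_mul hx.le, sqrt_sq hc.le,
    orbitIntegrand, smul_eq_mul]
  have h5 : 0 < √(2 - (1 + x) * sin ψ ^ 2) := sqrt_pos.2 (by
    nlinarith [sin_sq_le_one ψ])
  field_simp

lemma continuous_orbitIntegrand {g : ℝ → ℝ} (hg : Continuous g) {x : ℝ} (h1 : -1 < x)
    (h2 : x < 1) : Continuous (orbitIntegrand g x) := by
  refine (hg.comp (by fun_prop)).mul (Continuous.div (by fun_prop) (by fun_prop) fun ψ => ?_)
  exact (sqrt_pos.2 (by nlinarith [sin_sq_le_one ψ])).ne'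

lemma integrableOn_orbit_of_lt {g : ℝ → ℝ} (hg : Continuous g) {x : ℝ} (h1 : -1 < x)
    (h2 : x < 1) :
    IntegrableOn (fun θ => g (cos θ) * (√2 / √(x + 1 * cos θ))) (Ioo 0 (arccos (-x))) ∧
    ∫ θ in Ioo 0 (arccos (-x)), g (cos θ) * (√2 / √(x + 1 * cos θ)) =
      ∫ ψ in Ioo 0 (π / 2), orbitIntegrand g x ψ := by
  have hd : ∀ ψ ∈ Ioo 0 (π / 2), HasDerivWithinAt (orbitAngle x)
      (2 * √(1 + x) * cos ψ / √(2 - (1 + x) * sin ψ ^ 2)) (Ioo 0 (π / 2)) ψ :=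
    fun ψ hψ => (hasDerivAt_orbitAngle h1 h2 hψ).hasDerivWithinAt
  have hcongr : EqOn (fun ψ => |2 * √(1 + x) * cos ψ / √(2 - (1 + x) * sin ψ ^ 2)| •
      (g (cos (orbitAngle x ψ)) * (√2 / √(x + 1 * cos (orbitAngle x ψ)))))
      (orbitIntegrand g x) (Ioo 0 (π / 2)) := fun ψ hψ => orbitAngle_smul g h1 h2 hψ
  rw [← image_orbitAngle h1 h2]
  constructor
  · rw [integrableOn_image_iff_integrableOn_abs_deriv_smul measurableSet_Ioo hd
      (injOn_orbitAngle h1 h2) fun θ => g (cos θ) * (√2 / √(x + 1 * cos θ)),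
      integrableOn_congr_fun hcongr measurableSet_Ioo]
    exact (continuous_orbitIntegrand hg h1 h2).integrableOn_Icc.mono_set Ioo_subset_Icc_self
  · rw [integral_image_eq_integral_abs_deriv_smul measurableSet_Ioo hd
      (injOn_orbitAngle h1 h2) fun θ => g (cos θ) * (√2 / √(x + 1 * cos θ)),
      setIntegral_congr_fun measurableSet_Ioo hcongr]

/-- Beyond the turning point the default values of root and quotient make the integrand vanish, so
orbit integrals may be taken over the whole half circle. -/
lemma inv_sqrt_eq_zero_of_mem {x θ : ℝ} (h1 : -1 < x) (h2 : x < 1)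
    (hθ : θ ∈ Icc (arccos (-x)) π) : √2 / √(x + 1 * cos θ) = 0 := by
  have hc : cos θ ≤ -x := by
    rw [← cos_arccos (x := -x) (by linarith) (by linarith)]
    exact strictAntiOn_cos.antitoneOn ⟨arccos_nonneg _, arccos_le_pi _⟩
      ⟨(arccos_nonneg _).trans hθ.1, hθ.2⟩ hθ.1
  rw [sqrt_eq_zero_of_nonpos (show x + 1 * cos θ ≤ 0 by linarith), div_zero]

lemma half_orbit_of_lt {g : ℝ → ℝ} (hg : Continuous g) {x : ℝ} (h1 : -1 < x) (h2 : x < 1) :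
    IntervalIntegrable (fun θ => g (cos θ) * (√2 / √(x + 1 * cos θ))) volume 0 π ∧
    ∫ θ in (0 : ℝ)..π, g (cos θ) * (√2 / √(x + 1 * cos θ)) =
      ∫ ψ in (0 : ℝ)..(π / 2), orbitIntegrand g x ψ := by
  obtain ⟨hi, he⟩ := integrableOn_orbit_of_lt hg h1 h2
  have ha := arccos_nonneg (-x)
  have hp := arccos_le_pi (-x)
  have hz : EqOn (fun θ => g (cos θ) * (√2 / √(x + 1 * cos θ))) (fun _ => 0)
      (uIcc (arccos (-x)) π) := by
    intro θ hθ
    rw [uIcc_of_le hp] at hθ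
    simp only [inv_sqrt_eq_zero_of_mem h1 h2 hθ, mul_zero]
  have hi1 : IntervalIntegrable (fun θ => g (cos θ) * (√2 / √(x + 1 * cos θ))) volume 0
      (arccos (-x)) := (intervalIntegrable_iff_integrableOn_Ioo_of_le ha).2 hi
  have hi2 : IntervalIntegrable (fun θ => g (cos θ) * (√2 / √(x + 1 * cos θ))) volume
      (arccos (-x)) π :=
    (intervalIntegrable_const (c := (0 : ℝ))).congr fun θ hθ => (hz (uIoc_subset_uIcc hθ)).symm
  refine ⟨hi1.trans hi2, ?_⟩
  rw [← intervalIntegral.integral_add_adjacent_intervals hi1 hi2,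
    intervalIntegral.integral_congr hz, intervalIntegral.integral_zero, add_zero,
    intervalIntegral.integral_of_le ha, intervalIntegral.integral_of_le (by positivity),
    integral_Ioc_eq_integral_Ioo, integral_Ioc_eq_integral_Ioo, he]

lemma half_orbit_of_gt {g : ℝ → ℝ} (hg : Continuous g) {x : ℝ} (h : 1 < x) :
    Continuous (fun θ => g (cos θ) * (√2 / √(x + 1 * cos θ))) := by
  refine (hg.comp (by fun_prop)).mul (Continuous.div (by fun_prop) (by fun_prop) fun θ => ?_)
  exact (sqrt_pos.2 (by linarith [neg_one_le_cos θ])).ne'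

lemma half_orbit_intervalIntegrable {g : ℝ → ℝ} (hg : Continuous g) {x : ℝ} (h1 : -1 < x)
    (h2 : x ≠ 1) :
    IntervalIntegrable (fun θ => g (cos θ) * (√2 / √(x + 1 * cos θ))) volume 0 π := by
  rcases lt_or_gt_of_ne h2 with h | h
  · exact (half_orbit_of_lt hg h1 h).1
  · exact (half_orbit_of_gt hg h).intervalIntegrable _ _

/-- Integrals of functions of `cos` over the torus reduce to the half circle. -/
lemma integral_torus_eq_two_mul {f : ℝ → ℝ} (hi : IntervalIntegrable f volume 0 π)
    (hs : ∀ θ, f (2 * π - θ) = f θ) :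
    IntervalIntegrable f volume 0 (2 * π) ∧
    ∫ θ in (0 : ℝ)..(2 * π), f θ = 2 * ∫ θ in (0 : ℝ)..π, f θ := by
  have hf : (fun θ => f (2 * π - θ)) = f := funext hs
  have hi2 : IntervalIntegrable f volume π (2 * π) := by
    have h := (hi.comp_sub_left (2 * π)).symm
    simp only [hf, sub_zero] at h
    rwa [show 2 * π - π = π by ring] at h
  refine ⟨hi.trans hi2, ?_⟩
  rw [← intervalIntegral.integral_add_adjacent_intervals hi hi2]
  have : ∫ θ in π..(2 * π), f θ = ∫ θ in (0 : ℝ)..π, f θ := by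
    have h := intervalIntegral.integral_comp_sub_left (a := 0) (b := π) f (2 * π)
    simp only [hs, sub_zero] at h
    rw [h, show 2 * π - π = π by ring]
  rw [this]; ring

lemma orbitInt_eq_half {g : ℝ → ℝ} (hg : Continuous g) {x : ℝ} (h1 : -1 < x) (h2 : x ≠ 1) :
    IntervalIntegrable (fun θ => g (cos θ) * (√2 / √(x + 1 * cos θ))) volume 0 (2 * π) ∧
    orbitInt (fun θ => g (cos θ)) 1 x =
      2 * ∫ θ in (0 : ℝ)..π, g (cos θ) * (√2 / √(x + 1 * cos θ)) :=
  integral_torus_eq_two_mul (half_orbit_intervalIntegrable hg h1 h2) fun θ => by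
    rw [cos_two_pi_sub]

/-- Dominated convergence. Below the separatrix the turning point moves with `x`, so it is applied
on the fixed range of `ψ`, where `y < (x + 1) / 2` keeps the expression under the root above `(1 -
x) / 2`. Above the separatrix `y + cos θ ≥ (x - 1) / 2` suffices. -/
lemma continuousAt_orbitInt {g : ℝ → ℝ} (hg : Continuous g)
    (hb : ∀ u ∈ Icc (-1 : ℝ) 1, |g u| ≤ 1) {x : ℝ} (h1 : -1 < x) (h2 : x ≠ 1) :
    ContinuousAt (orbitInt (fun θ => g (cos θ)) 1) x := by
  rcases lt_or_gt_of_ne h2 with h | h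
  · have hev : ∀ᶠ y in 𝓝 x, y ∈ Ioo (-1) ((x + 1) / 2) :=
      Ioo_mem_nhds h1 (by linarith)
    have hcont : ContinuousAt (fun y => 2 * ∫ ψ in (0 : ℝ)..(π / 2), orbitIntegrand g y ψ) x := by
      refine continuousAt_const.mul (intervalIntegral.continuousAt_of_dominated_interval
        (bound := fun _ => 2 * √2 / √((1 - x) / 2)) ?_ ?_ intervalIntegrable_const ?_)
      · filter_upwards [hev] with y hy
        exact (continuous_orbitIntegrand hg hy.1 (by linarith [hy.2])).aestronglyMeasurable
      · filter_upwards [hev] with y hy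
        refine Eventually.of_forall fun ψ _ => ?_
        have hs := sin_sq_le_one ψ
        have hs0 := sq_nonneg (sin ψ)
        have hy1 := hy.1
        have hy2 := hy.2
        have hle : √((1 - x) / 2) ≤ √(2 - (1 + y) * sin ψ ^ 2) :=
          sqrt_le_sqrt (by nlinarith)
        have hpos : 0 < √((1 - x) / 2) := sqrt_pos.2 (by linarith)
        rw [orbitIntegrand, norm_mul, Real.norm_eq_abs,
          Real.norm_of_nonneg (show 0 ≤ 2 * √2 / √(2 - (1 + y) * sin ψ ^ 2) by positivity)]
        calc _ ≤ 1 * (2 * √2 / √(2 - (1 + y) * sin ψ ^ 2)) :=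
              mul_le_mul_of_nonneg_right (hb _ ⟨by nlinarith, by nlinarith⟩) (by positivity)
          _ ≤ _ := by
              rw [one_mul]; exact div_le_div_of_nonneg_left (by positivity) hpos hle
      · refine Eventually.of_forall fun ψ _ => ?_
        have hpos : √(2 - (1 + x) * sin ψ ^ 2) ≠ 0 :=
          (sqrt_pos.2 (by nlinarith [sin_sq_le_one ψ])).ne'
        unfold orbitIntegrand
        exact ContinuousAt.mul (Continuous.continuousAt (by fun_prop))
          (ContinuousAt.div continuousAt_const (Continuous.continuousAt (by fun_prop)) hpos)
    refine hcont.congr ?_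
    filter_upwards [hev] with y hy
    have hy2 : y < 1 := by linarith [hy.2]
    rw [(orbitInt_eq_half hg hy.1 hy2.ne).2, (half_orbit_of_lt hg hy.1 hy2).2]
  · have hev : ∀ᶠ y in 𝓝 x, (x + 1) / 2 < y := Ioi_mem_nhds (by linarith)
    unfold orbitInt
    refine intervalIntegral.continuousAt_of_dominated_interval
      (bound := fun _ => √2 / √((x - 1) / 2)) ?_ ?_ intervalIntegrable_const ?_
    · filter_upwards [hev] with y hy
      exact (half_orbit_of_gt hg (by linarith)).aestronglyMeasurable
    · filter_upwards [hev] with y hy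
      refine Eventually.of_forall fun θ _ => ?_
      have hc := neg_one_le_cos θ
      have hle : √((x - 1) / 2) ≤ √(y + 1 * cos θ) := sqrt_le_sqrt (by linarith)
      have hpos : 0 < √((x - 1) / 2) := sqrt_pos.2 (by linarith)
      rw [norm_mul, Real.norm_eq_abs,
        Real.norm_of_nonneg (show 0 ≤ √2 / √(y + 1 * cos θ) by positivity)]
      calc _ ≤ 1 * (√2 / √(y + 1 * cos θ)) :=
            mul_le_mul_of_nonneg_right (hb _ ⟨hc, cos_le_one θ⟩) (by positivity)
        _ ≤ _ := by
            rw [one_mul]; exact div_le_div_of_nonneg_left (by positivity) hpos hle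
    · refine Eventually.of_forall fun θ _ => ?_
      have hpos : √(x + 1 * cos θ) ≠ 0 := (sqrt_pos.2 (by linarith [neg_one_le_cos θ])).ne'
      exact ContinuousAt.mul continuousAt_const
          (ContinuousAt.div continuousAt_const (Continuous.continuousAt (by fun_prop)) hpos)

lemma orbitInt_one_pos {x : ℝ} (h1 : -1 < x) (h2 : x ≠ 1) :
    0 < orbitInt (fun _ => 1) 1 x := by
  have hh := (orbitInt_eq_half (g := fun _ => 1) continuous_const h1 h2).2
  rw [hh]
  refine mul_pos two_pos ?_
  rcases lt_or_gt_of_ne h2 with h | h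
  · rw [(half_orbit_of_lt (g := fun _ => 1) continuous_const h1 h).2]
    refine intervalIntegral.intervalIntegral_pos_of_pos
      ((continuous_orbitIntegrand continuous_const h1 h).intervalIntegrable _ _) (fun ψ => ?_)
      (by positivity)
    have : 0 < √(2 - (1 + x) * sin ψ ^ 2) := sqrt_pos.2 (by nlinarith [sin_sq_le_one ψ])
    rw [orbitIntegrand]; positivity
  · refine intervalIntegral.intervalIntegral_pos_of_pos
      ((half_orbit_of_gt (g := fun _ => 1) continuous_const h).intervalIntegrable _ _)
      (fun θ => ?_) pi_pos
    have : 0 < √(x + 1 * cos θ) := sqrt_pos.2 (by linarith [neg_one_le_cos θ])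
    positivity

/-! #### The orbit averages -/

lemma div_mem_of_lt {m e : ℝ} (hm : 0 < m) (h1 : -m < e) (h2 : e ≠ m) :
    -1 < e / m ∧ e / m ≠ 1 := by
  constructor
  · rw [lt_div_iff₀ hm]; linarith
  · rwa [Ne, div_eq_one_iff_eq hm.ne']

lemma inv_sqrt_scaling {m : ℝ} (hm : 0 < m) (e θ : ℝ) :
    √2 / √(e + m * cos θ) = (√m)⁻¹ * (√2 / √(e / m + 1 * cos θ)) := by
  have : e + m * cos θ = m * (e / m + 1 * cos θ) := by field_simp
  rw [this, sqrt_mul hm.le, div_mul_eq_div_div_swap, div_eq_mul_inv _ (√m)]; ring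

lemma intervalIntegrable_orbit {g : ℝ → ℝ} (hg : Continuous g) {m e : ℝ} (hm : 0 < m)
    (h1 : -m < e) (h2 : e ≠ m) :
    IntervalIntegrable (fun θ => g (cos θ) * (√2 / √(e + m * cos θ))) volume 0 π ∧
    IntervalIntegrable (fun θ => g (cos θ) * (√2 / √(e + m * cos θ))) volume 0 (2 * π) := by
  obtain ⟨h3, h4⟩ := div_mem_of_lt hm h1 h2
  have : (fun θ => g (cos θ) * (√2 / √(e + m * cos θ))) =
      fun θ => (√m)⁻¹ * (g (cos θ) * (√2 / √(e / m + 1 * cos θ))) := by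
    ext θ; rw [inv_sqrt_scaling hm]; ring
  rw [this]
  exact ⟨(half_orbit_intervalIntegrable hg h3 h4).const_mul _,
    ((orbitInt_eq_half hg h3 h4).1).const_mul _⟩

lemma angle_mem {m e : ℝ} : angle m e ∈ Icc 0 π := by
  rw [angle]
  split_ifs
  · exact ⟨le_rfl, pi_pos.le⟩
  · exact ⟨arccos_nonneg _, arccos_le_pi _⟩
  · exact ⟨pi_pos.le, le_rfl⟩

/-- Of the factor `2√2`, the `2` comes from folding the torus onto the half circle and the `√2` from
the normalisation of `orbitInt`. It cancels in the orbit averages. -/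
lemma integral_angle {g : ℝ → ℝ} (hg : Continuous g) {m e : ℝ} (hm : 0 < m)
    (h1 : -m < e) (h2 : e ≠ m) :
    IntervalIntegrable (fun θ => g (cos θ) / √(e + m * cos θ)) volume 0 (angle m e) ∧
    2 * √2 * ∫ θ in (0 : ℝ)..(angle m e), g (cos θ) / √(e + m * cos θ) =
      orbitInt (fun θ => g (cos θ)) m e := by
  have hform : (fun θ => g (cos θ) / √(e + m * cos θ)) =
      fun θ => (√2)⁻¹ * (g (cos θ) * (√2 / √(e + m * cos θ))) := by
    ext θ
    have := (sqrt_pos.2 (two_pos (α := ℝ))).ne'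
    field_simp
  have hiπ := (intervalIntegrable_orbit hg hm h1 h2).1.const_mul (√2)⁻¹
  rw [← hform] at hiπ
  have hmem := angle_mem (m := m) (e := e)
  have hi1 : IntervalIntegrable (fun θ => g (cos θ) / √(e + m * cos θ)) volume 0 (angle m e) :=
    hiπ.mono_set (by rw [uIcc_of_le hmem.1, uIcc_of_le pi_pos.le]; exact Icc_subset_Icc_right hmem.2)
  have hi2 : IntervalIntegrable (fun θ => g (cos θ) / √(e + m * cos θ)) volume (angle m e) π :=
    hiπ.mono_set (by rw [uIcc_of_le hmem.2, uIcc_of_le pi_pos.le]; exact Icc_subset_Icc_left hmem.1)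
  refine ⟨hi1, ?_⟩
  have hzero : ∫ θ in (angle m e)..π, g (cos θ) / √(e + m * cos θ) = 0 := by
    rcases lt_or_gt_of_ne h2 with h | h
    · rw [← intervalIntegral.integral_zero (a := angle m e) (b := π) (μ := volume)]
      refine intervalIntegral.integral_congr fun θ hθ => ?_
      rw [uIcc_of_le hmem.2, angle, if_neg (not_le.2 h1), if_pos h] at hθ
      have h3 := (div_mem_of_lt hm h1 h2).1
      have h4 : e / m < 1 := (div_lt_one hm).2 h
      have hc : cos θ ≤ -e / m := by
        rw [← cos_arccos (x := -e / m) (by rw [neg_div]; linarith) (by rw [neg_div]; linarith)]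
        exact strictAntiOn_cos.antitoneOn ⟨arccos_nonneg _, arccos_le_pi _⟩
          ⟨(arccos_nonneg _).trans hθ.1, hθ.2⟩ hθ.1
      have : e + m * cos θ ≤ 0 := by
        rw [le_div_iff₀ hm] at hc; linarith
      simp only [sqrt_eq_zero_of_nonpos this, div_zero]
    · rw [angle, if_neg (not_le.2 h1), if_neg (not_lt.2 h.le), intervalIntegral.integral_same]
  have hadd := intervalIntegral.integral_add_adjacent_intervals hi1 hi2
  rw [hzero, add_zero] at hadd
  obtain ⟨h3, h4⟩ := div_mem_of_lt hm h1 h2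
  rw [orbitInt_scaling _ hm, (orbitInt_eq_half hg h3 h4).2, hadd, hform,
    intervalIntegral.integral_const_mul]
  simp only [inv_sqrt_scaling hm e]
  have hcomm : ∀ θ, g (cos θ) * ((√m)⁻¹ * (√2 / √(e / m + 1 * cos θ))) =
      (√m)⁻¹ * (g (cos θ) * (√2 / √(e / m + 1 * cos θ))) := fun θ => by ring
  simp only [hcomm]
  rw [intervalIntegral.integral_const_mul]
  have := (sqrt_pos.2 (two_pos (α := ℝ))).ne'
  field_simp

lemma orbitInt_pos {m e : ℝ} (hm : 0 < m) (h1 : -m < e) (h2 : e ≠ m) :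
    0 < orbitInt (fun _ => 1) m e := by
  obtain ⟨h3, h4⟩ := div_mem_of_lt hm h1 h2
  rw [orbitInt_scaling _ hm]
  have := sqrt_pos.2 hm
  exact mul_pos (by positivity) (orbitInt_one_pos h3 h4)

lemma orbitWeight_pos {m e : ℝ} (hm : 0 < m) (h1 : -m < e) (h2 : e ≠ m) :
    0 < orbitWeight m e := by
  have h := (integral_angle (g := fun _ => 1) continuous_const hm h1 h2).2
  have hp := orbitInt_pos hm h1 h2
  rw [← h] at hp
  exact pos_of_mul_pos_right hp (by positivity)

/-- The average of `cos` over an orbit, as a quotient of derivatives of areas. -/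
def cosMean (m e : ℝ) : ℝ := orbitInt cos m e / orbitInt (fun _ => 1) m e

lemma orbitCos_eq_cosMean {m e : ℝ} (hm : 0 < m) (h1 : -m < e) (h2 : e ≠ m) :
    orbitCos m e = cosMean m e := by
  have h3 := (integral_angle (g := fun _ => 1) continuous_const hm h1 h2).2
  have h4 := (integral_angle (g := fun u => u) continuous_id hm h1 h2).2
  rw [orbitCos, cosMean, orbitWeight, ← h3]
  change _ = orbitInt (fun θ => cos θ) m e / _
  rw [← h4, mul_div_mul_left _ _ (by positivity)]

lemma cosMean_scaling {m : ℝ} (hm : 0 < m) (e : ℝ) : cosMean m e = cosMean 1 (e / m) := by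
  have := sqrt_pos.2 hm
  rw [cosMean, orbitInt_scaling _ hm, orbitInt_scaling _ hm, mul_div_mul_left _ _ (by positivity),
    cosMean]

lemma continuousAt_cosMean {x : ℝ} (h1 : -1 < x) (h2 : x ≠ 1) : ContinuousAt (cosMean 1) x :=
  (continuousAt_orbitInt (g := fun u => u) continuous_id (fun _ hu => abs_le.2 hu) h1 h2).div
    (continuousAt_orbitInt (g := fun _ => 1) continuous_const (by simp) h1 h2)
    (orbitInt_one_pos h1 h2).ne'

lemma measurable_cosMean (m : ℝ) : Measurable (cosMean m) :=
  (stronglyMeasurable_orbitInt continuous_cos m).measurable.div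
    (stronglyMeasurable_orbitInt continuous_const m).measurable

lemma abs_cosMean_le {m e : ℝ} : |cosMean m e| ≤ 1 := by
  by_cases hi : IntervalIntegrable (fun θ => 1 * (√2 / √(e + m * cos θ))) volume 0 (2 * π)
  · rw [cosMean, abs_div]
    refine div_le_one_of_le₀ ?_ (abs_nonneg _)
    have hle : ‖∫ θ in (0 : ℝ)..(2 * π), cos θ * (√2 / √(e + m * cos θ))‖ ≤
        ∫ θ in (0 : ℝ)..(2 * π), 1 * (√2 / √(e + m * cos θ)) := by
      refine intervalIntegral.norm_integral_le_of_norm_le two_pi_nonneg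
        (Eventually.of_forall fun θ _ => ?_) hi
      rw [norm_mul, Real.norm_of_nonneg (show 0 ≤ √2 / √(e + m * cos θ) by positivity)]
      exact mul_le_mul_of_nonneg_right (abs_cos_le_one θ) (by positivity)
    exact hle.trans (le_abs_self _)
  -- A divergent orbit integral has the default value `0`, and so does the quotient by it.
  · have : orbitInt (fun _ => 1) m e = 0 := intervalIntegral.integral_undef hi
    rw [cosMean, this, div_zero, abs_zero]
    exact zero_le_one

lemma hasDerivAt_slab_one {x : ℝ} (h1 : -1 < x) (h2 : x ≠ 1) :
    HasDerivAt (slab (fun _ => 1) 1) (orbitInt (fun _ => 1) 1 x) x ∧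
    HasDerivAt (slab cos 1) (orbitInt cos 1 x) x :=
  ⟨hasDerivAt_slab continuous_const (by simp)
    (continuousAt_orbitInt (g := fun _ => 1) continuous_const (by simp) h1 h2),
    hasDerivAt_slab continuous_cos abs_cos_le_one
    (continuousAt_orbitInt (g := fun u => u) continuous_id (fun _ hu => abs_le.2 hu) h1 h2)⟩


/-! ### Second derivative -/

lemma hasDerivAt_invArea {y : ℝ} (hy : 0 < y) (h1 : invArea y ≠ 1) :
    HasDerivAt invArea (orbitInt (fun _ => 1) 1 (invArea y))⁻¹ y := by
  refine HasDerivAt.of_local_left_inverse continuous_invArea.continuousAt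
    (hasDerivAt_slab_one (neg_one_lt_invArea hy) h1).1
    (orbitInt_one_pos (neg_one_lt_invArea hy) h1).ne' ?_
  filter_upwards [Ioi_mem_nhds hy] with z hz
  rw [← area_eq_slab, area_invArea (le_of_lt hz)]

/-- `∬ cos θ` over the sublevel set of area `y`, for `φ = - cos`. -/
def cosArea (y : ℝ) : ℝ := slab cos 1 (invArea y)

lemma continuous_cosArea : Continuous cosArea :=
  (continuous_slab continuous_cos).comp
    (continuous_const.prodMk continuous_invArea : Continuous fun y => ((1 : ℝ), invArea y))

lemma abs_cosArea_le {y : ℝ} (hy : 0 ≤ y) : |cosArea y| ≤ y := by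
  have := abs_slab_le continuous_cos abs_cos_le_one zero_le_one (invArea y)
  rwa [area_invArea hy] at this

lemma abs_cosArea_sub_le {y z : ℝ} (hy : 0 ≤ y) (hz : 0 ≤ z) :
    |cosArea y - cosArea z| ≤ |y - z| := by
  have key : ∀ {y z : ℝ}, 0 ≤ y → 0 ≤ z → z ≤ y → |cosArea y - cosArea z| ≤ |y - z| := by
    intro y z hy hz h
    have := abs_slab_sub_le continuous_cos abs_cos_le_one 1 (strictMono_invArea.monotone h)
    rw [area_invArea hy, area_invArea hz] at this
    exact this.trans (le_abs_self _)
  rcases le_total z y with h | h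
  · exact key hy hz h
  · rw [abs_sub_comm, abs_sub_comm y]; exact key hz hy h

lemma hasDerivAt_cosArea {y : ℝ} (hy : 0 < y) (h1 : invArea y ≠ 1) :
    HasDerivAt cosArea (cosMean 1 (invArea y)) y := by
  have h := (hasDerivAt_slab_one (neg_one_lt_invArea hy) h1).2.comp y (hasDerivAt_invArea hy h1)
  rwa [← div_eq_mul_inv] at h

/-- `∬ cos θ` over the sublevel set of area `s`, for `φ = - m cos`. -/
def levelCos (m s : ℝ) : ℝ := √m * cosArea (s / √m)

lemma levelCos_eq {m : ℝ} (hm : 0 < m) (s : ℝ) : levelCos m s = slab cos m (levelEnergy m s) := by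
  rw [slab_scaling _ hm, levelCos, cosArea, levelEnergy, mul_div_cancel_left₀ _ hm.ne']

/-- `∫ (cos θ - c)² √2 (e + m cos θ)^{-1/2} dθ`, where `c` is the average of `cos` over the
orbit of energy `e`, in terms of areas. -/
def orbitVar (m e : ℝ) : ℝ :=
  (slab cos m e - cosMean m e * area (cosPot m) e) / (2 * m)

lemma abs_orbitVar_le {m e : ℝ} (hm : 0 < m) : |orbitVar m e| ≤ area (cosPot m) e / m := by
  have h1 := abs_slab_le continuous_cos abs_cos_le_one hm.le e
  have h2 : |cosMean m e * area (cosPot m) e| ≤ area (cosPot m) e := by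
    rw [abs_mul, abs_of_nonneg (area_nonneg _ _)]
    exact mul_le_of_le_one_left (area_nonneg _ _) abs_cosMean_le
  rw [orbitVar, abs_div, abs_of_pos (show 0 < 2 * m by positivity),
    div_le_div_iff₀ (by positivity) hm]
  have h3 := (abs_sub (slab cos m e) (cosMean m e * area (cosPot m) e))
  nlinarith

lemma measurable_orbitVar (m : ℝ) : Measurable (orbitVar m) := by
  have h1 : Measurable (slab cos m) :=
    ((continuous_slab continuous_cos).comp (by fun_prop : Continuous fun e : ℝ => (m, e))).measurable
  exact ((h1.sub ((measurable_cosMean m).mul (continuous_area_right m).measurable)).div_const _)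

/-- The derivative of `levelCos` with respect to `m`. -/
def levelVar (m s : ℝ) : ℝ :=
  (cosArea (s / √m) - cosMean 1 (invArea (s / √m)) * (s / √m)) / (2 * √m)

lemma levelVar_eq {m s : ℝ} (hm : 0 < m) (hs : 0 ≤ s) :
    levelVar m s = orbitVar m (levelEnergy m s) := by
  have h := sqrt_pos.2 hm
  have h2 : m = √m * √m := (mul_self_sqrt hm.le).symm
  rw [orbitVar, ← levelCos_eq hm, area_levelEnergy hm hs, cosMean_scaling hm, levelEnergy,
    mul_div_cancel_left₀ _ hm.ne', levelVar, levelCos]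
  generalize invArea (s / √m) = x
  generalize cosArea (s / √m) = y
  have h3 : (2 * m : ℝ) = 2 * (√m * √m) := by rw [← h2]
  rw [h3]
  field_simp

lemma hasDerivAt_levelCos {m s : ℝ} (hm : 0 < m) (hs : 0 < s) (h1 : invArea (s / √m) ≠ 1) :
    HasDerivAt (fun m => levelCos m s) (levelVar m s) m := by
  have h := sqrt_pos.2 hm
  have hd1 : HasDerivAt (fun m => √m) (1 / (2 * √m)) m := hasDerivAt_sqrt hm.ne'
  have hd2 : HasDerivAt (fun m => s / √m) (-(s * (1 / (2 * √m))) / √m ^ 2) m := by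
    exact ((hasDerivAt_const m s).div hd1 h.ne').congr_deriv (by rw [zero_mul, zero_sub])
  have hd3 := (hasDerivAt_cosArea (by positivity) h1).comp m hd2
  refine (hd1.mul hd3).congr_deriv ?_
  rw [levelVar, Function.comp_apply]
  field_simp
  ring

/-- A Lipschitz bound is used since, for fixed `s`, differentiability in `m` can fail where the
level crosses the separatrix. Varying the prefactor `√m` and varying the argument of the 1-Lipschitz
`cosArea` each cost `|√a - √b| s / √a`, and `|√a - √b| ≤ |a - b| / (2√d)`. -/
lemma abs_levelCos_sub_le {a b d s : ℝ} (hd : 0 < d) (ha : d ≤ a) (hb : d ≤ b) (hs : 0 ≤ s) :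
    |levelCos a s - levelCos b s| ≤ s / d * |a - b| := by
  have hr := sqrt_pos.2 hd
  have hp : √d ≤ √a := sqrt_le_sqrt ha
  have hq : √d ≤ √b := sqrt_le_sqrt hb
  have hp0 := hr.trans_le hp
  have hq0 := hr.trans_le hq
  have h1 : levelCos a s - levelCos b s = (√a - √b) * cosArea (s / √a) +
      √b * (cosArea (s / √a) - cosArea (s / √b)) := by
    rw [levelCos, levelCos]; ring
  have h2 : |(√a - √b) * cosArea (s / √a)| ≤ |√a - √b| * (s / √a) := by
    rw [abs_mul]
    exact mul_le_mul_of_nonneg_left (abs_cosArea_le (by positivity)) (abs_nonneg _)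
  have h3 : |√b * (cosArea (s / √a) - cosArea (s / √b))| ≤ |√a - √b| * (s / √a) := by
    rw [abs_mul, abs_of_pos hq0]
    refine (mul_le_mul_of_nonneg_left (abs_cosArea_sub_le (by positivity) (by positivity))
      hq0.le).trans_eq ?_
    have : s / √a - s / √b = (√b - √a) * (s / √a / √b) := by field_simp
    rw [this, abs_mul, abs_of_nonneg (show 0 ≤ s / √a / √b by positivity), abs_sub_comm]
    field_simp
  have h4 : |√a - √b| * (√a + √b) = |a - b| := by
    rw [← abs_of_pos (show 0 < √a + √b by positivity), ← abs_mul]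
    congr 1
    have := mul_self_sqrt (hd.le.trans ha)
    have := mul_self_sqrt (hd.le.trans hb)
    linarith
  have h5 : |√a - √b| * (2 * √d) ≤ |a - b| := by
    rw [← h4]; exact mul_le_mul_of_nonneg_left (by linarith) (abs_nonneg _)
  have h6 : s / √a ≤ s / √d := div_le_div_of_nonneg_left hs hr hp
  have h7 : s / d = s / √d / √d := by rw [div_div, mul_self_sqrt hd.le]
  calc |levelCos a s - levelCos b s| ≤ 2 * (|√a - √b| * (s / √a)) := by
        rw [h1]; refine (abs_add_le _ _).trans (by linarith)
    _ ≤ 2 * (|√a - √b| * (s / √d)) := by gcongr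
    _ = (s / √d / √d) * (|√a - √b| * (2 * √d)) := by field_simp
    _ ≤ (s / √d / √d) * |a - b| := by gcongr
    _ = s / d * |a - b| := by rw [h7]

section Layers

variable {Q : ℝ → ℝ}

/-- The layer-cake formula with `g = 1`: the sublevel set in layer `s` has measure `s`, and the
rearrangement is integrable. This supplies every dominating function on the layers. -/
lemma IsProfile.integrable_id (h : IsProfile Q) : Integrable (fun s => s) h.layers := by
  have h0 : Integrable (fun p => 1 * layered Q 1 p) phase :=
    h.integrable_mul_layered zero_le_one (C := 1) continuous_const fun p => by
      simpa using sq_nonneg p.2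
  have h1 := (h.integral_eq_layers (g := fun _ => 1) measurable_const
    (continuous_area_energy_right 1).measurable (fun p => area_nonneg _ _) h0).1
  refine h1.congr ?_
  filter_upwards [h.ae_pos] with s hs
  rw [setIntegral_const, measureReal_def, phase_area_lt zero_le_one hs.le,
    ENNReal.toReal_ofReal hs.le]
  simp

lemma setIntegral_cos {m s : ℝ} (hm : 0 < m) (hs : 0 ≤ s) :
    ∫ p in {p | area (cosPot m) (energy (cosPot m) p) < s}, cos p.1 ∂phase = levelCos m s := by
  have h1 := setOf_area_lt hm.le (neg_le_levelEnergy hm hs)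
  rw [area_levelEnergy hm hs] at h1
  rw [h1, setIntegral_sublevel continuous_cos abs_cos_le_one, levelCos_eq hm]

lemma IsProfile.magnetization_eq (h : IsProfile Q) {m : ℝ} (hm : 0 < m) :
    Integrable (levelCos m) h.layers ∧ magnetization Q m = ∫ s, levelCos m s ∂h.layers := by
  obtain ⟨h1, h2⟩ := h.integral_eq_layers (g := fun p => cos p.1) (Measurable.cos measurable_fst)
    (continuous_area_energy_right m).measurable (fun p => area_nonneg _ _)
    (h.integrable_cos_mul hm.le)
  have hc : (fun s => ∫ p in {p | area (cosPot m) (energy (cosPot m) p) < s}, cos p.1 ∂phase)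
      =ᵐ[h.layers] levelCos m := by
    filter_upwards [h.ae_pos] with s hs
    exact setIntegral_cos hm hs.le
  exact ⟨h1.congr hc, h2.trans (integral_congr_ae hc)⟩

lemma ne_one_of_ne {m s : ℝ} (hm : 0 < m) (hs : 0 < s) (hne : s ≠ √m * area (cosPot 1) 1) :
    invArea (s / √m) ≠ 1 := by
  have := sqrt_pos.2 hm
  intro h
  apply hne
  have h1 := area_invArea (show 0 ≤ s / √m by positivity)
  rw [h] at h1
  rw [h1]
  field_simp

lemma measurable_levelVar (m : ℝ) : Measurable (levelVar m) := by
  unfold levelVar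
  have h1 := continuous_cosArea.measurable
  have h2 := measurable_cosMean 1
  have h3 := continuous_invArea.measurable
  fun_prop

lemma abs_levelVar_le {m s : ℝ} (hm : 0 < m) (hs : 0 ≤ s) : |levelVar m s| ≤ s / m := by
  rw [levelVar_eq hm hs]
  refine (abs_orbitVar_le hm).trans_eq ?_
  rw [area_levelEnergy hm hs]

/-- Differentiation under the integral, with the Lipschitz constant `s / (m / 2)` on `(m / 2, ∞)`.
At the given `m` only `s = √m · area (cosPot 1) 1` lies on the separatrix, and it carries no mass.
-/
lemma IsProfile.hasDerivAt_magnetization (h : IsProfile Q) {m : ℝ} (hm : 0 < m) :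
    HasDerivAt (magnetization Q) (∫ s, levelVar m s ∂h.layers) m := by
  have key := hasDerivAt_integral_of_dominated_loc_of_lip (μ := h.layers) (x₀ := m)
    (s := Ioi (m / 2)) (F := levelCos) (F' := levelVar m) (bound := fun s => s / (m / 2))
    (Ioi_mem_nhds (by linarith)) ?_ (h.magnetization_eq hm).1
    (measurable_levelVar m).aestronglyMeasurable ?_ (h.integrable_id.div_const _) ?_
  · refine key.2.congr_of_eventuallyEq ?_
    filter_upwards [Ioi_mem_nhds hm] with n hn
    exact (h.magnetization_eq hn).2
  · filter_upwards [Ioi_mem_nhds hm] with n hn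
    exact (h.magnetization_eq hn).1.aestronglyMeasurable
  · filter_upwards [h.ae_pos] with s hs
    refine LipschitzOnWith.of_dist_le_mul fun a ha b hb => ?_
    rw [Real.dist_eq, Real.dist_eq, Real.coe_nnabs,
      abs_of_nonneg (show 0 ≤ s / (m / 2) by positivity)]
    exact abs_levelCos_sub_le (by positivity) (le_of_lt ha) (le_of_lt hb) hs.le
  · filter_upwards [h.ae_pos, h.ae_ne (√m * area (cosPot 1) 1)] with s hs hne
    exact hasDerivAt_levelCos hm hs (ne_one_of_ne hm hs hne)

lemma continuousAt_levelVar {m s : ℝ} (hm : 0 < m) (hs : 0 < s) (h1 : invArea (s / √m) ≠ 1) :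
    ContinuousAt (fun m => levelVar m s) m := by
  have h := sqrt_pos.2 hm
  have hq : ContinuousAt (fun m => s / √m) m :=
    continuousAt_const.div continuous_sqrt.continuousAt h.ne'
  have hc : ContinuousAt (fun m => cosMean 1 (invArea (s / √m))) m :=
    ContinuousAt.comp (f := fun m => invArea (s / √m)) (g := cosMean 1)
      (continuousAt_cosMean (neg_one_lt_invArea (by positivity)) h1)
      (continuous_invArea.continuousAt.comp hq)
  exact ((continuous_cosArea.continuousAt.comp hq).sub (hc.mul hq)).div
    (continuousAt_const.mul continuous_sqrt.continuousAt) (by positivity)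

lemma IsProfile.continuousAt_integral_levelVar (h : IsProfile Q) {m : ℝ} (hm : 0 < m) :
    ContinuousAt (fun m => ∫ s, levelVar m s ∂h.layers) m := by
  refine continuousAt_of_dominated (bound := fun s => s / (m / 2))
    (Eventually.of_forall fun n => (measurable_levelVar n).aestronglyMeasurable) ?_
    (h.integrable_id.div_const _) ?_
  · filter_upwards [Ioi_mem_nhds (show m / 2 < m by linarith)] with n hn
    rw [mem_Ioi] at hn
    filter_upwards [h.ae_pos] with s hs
    exact (abs_levelVar_le (by linarith) hs.le).trans
      (div_le_div_of_nonneg_left hs.le (by positivity) hn.le)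
  · filter_upwards [h.ae_pos, h.ae_ne (√m * area (cosPot 1) 1)] with s hs hne
    exact continuousAt_levelVar hm hs (ne_one_of_ne hm hs hne)

end Layers


/-! ### Integration over the energy levels -/

lemma setLIntegral_sq {s : Set ℝ} (hs : MeasurableSet s) (hinj : InjOn (fun v : ℝ => v ^ 2) s)
    (h0 : (0 : ℝ) ∉ s) {c : ℝ} (himg : (fun v : ℝ => v ^ 2 / 2 - c) '' s = Ioi (-c))
    (g : ℝ → ENNReal) :
    ∫⁻ v in s, g (v ^ 2 / 2 - c) =
      ∫⁻ e in Ioi (-c), ENNReal.ofReal (1 / √(2 * (e + c))) * g e := by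
  have hd : ∀ v ∈ s, HasDerivWithinAt (fun v : ℝ => v ^ 2 / 2 - c) v s v := fun v _ => by
    have := (((hasDerivAt_id v).pow 2).div_const 2).sub_const c
    refine (this.congr_deriv ?_).hasDerivWithinAt
    simp
  have hinj' : InjOn (fun v : ℝ => v ^ 2 / 2 - c) s := fun a ha b hb hab =>
    hinj ha hb (by simp only at hab ⊢; linarith)
  rw [← himg, lintegral_image_eq_lintegral_abs_deriv_mul hs hd hinj']
  refine setLIntegral_congr_fun hs fun v hv => ?_
  have hv0 : v ≠ 0 := fun h => h0 (h ▸ hv)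
  have h1 : 2 * (v ^ 2 / 2 - c + c) = v ^ 2 := by ring
  rw [h1, sqrt_sq_eq_abs, ← mul_assoc, ← ENNReal.ofReal_mul (abs_nonneg v),
    mul_one_div_cancel (abs_ne_zero.2 hv0), ENNReal.ofReal_one, one_mul]

/-- The change of variables `v ↦ v² / 2 - c`. -/
lemma lintegral_sq (c : ℝ) (g : ℝ → ENNReal) :
    ∫⁻ v : ℝ, g (v ^ 2 / 2 - c) = ∫⁻ e, ENNReal.ofReal (√2 / √(e + c)) * g e := by
  have himg1 : (fun v : ℝ => v ^ 2 / 2 - c) '' Ioi 0 = Ioi (-c) := by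
    ext e
    constructor
    · rintro ⟨v, hv, rfl⟩
      have : 0 < v ^ 2 := by rw [mem_Ioi] at hv; positivity
      simp only [mem_Ioi]; linarith
    · intro he
      rw [mem_Ioi] at he
      have h : 0 < 2 * (e + c) := by linarith
      refine ⟨√(2 * (e + c)), sqrt_pos.2 h, ?_⟩
      simp only [sq_sqrt h.le]; ring
  have himg2 : (fun v : ℝ => v ^ 2 / 2 - c) '' Iio 0 = Ioi (-c) := by
    rw [← himg1]
    ext e
    constructor
    · rintro ⟨v, hv, rfl⟩; exact ⟨-v, show (0 : ℝ) < -v from neg_pos.2 hv, by simp⟩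
    · rintro ⟨v, hv, rfl⟩; exact ⟨-v, show -v < (0 : ℝ) from neg_lt_zero.2 hv, by simp⟩
  have h1 := setLIntegral_sq measurableSet_Ioi
    (fun a (ha : 0 < a) b (hb : 0 < b) (hab : a ^ 2 = b ^ 2) =>
      (sq_eq_sq₀ ha.le hb.le).1 hab) (by simp) himg1 g
  have h2 := setLIntegral_sq measurableSet_Iio
    (fun a (ha : a < 0) b (hb : b < 0) (hab : a ^ 2 = b ^ 2) => by
      rcases sq_eq_sq_iff_eq_or_eq_neg.1 hab with h | h
      · exact h
      · linarith) (by simp) himg2 g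
  rw [← setLIntegral_univ, ← Iio_union_Ici (a := (0 : ℝ)),
    lintegral_union measurableSet_Ici (Iio_disjoint_Ici le_rfl),
    ← setLIntegral_congr (Ioi_ae_eq_Ici (a := (0 : ℝ)) (μ := volume)), h1, h2, ← two_mul,
    ← lintegral_const_mul' _ _ (by simp), ← lintegral_indicator measurableSet_Ioi]
  refine lintegral_congr fun e => ?_
  by_cases he : e ∈ Ioi (-c)
  · rw [indicator_of_mem he, ← mul_assoc]
    congr 1
    rw [mem_Ioi] at he
    have hpos : 0 < √(e + c) := sqrt_pos.2 (by linarith)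
    have h3 : (2 : ENNReal) = ENNReal.ofReal 2 := by simp
    rw [h3, ← ENNReal.ofReal_mul two_pos.le, sqrt_mul two_pos.le]
    congr 1
    have h4 : √2 * √2 = 2 := mul_self_sqrt two_pos.le
    have := sqrt_pos.2 (two_pos (α := ℝ))
    field_simp
    linarith
  · rw [indicator_of_notMem he]
    rw [mem_Ioi, not_lt] at he
    -- Energies not attained at this angle get density `0` from the default values, so the integral
    -- may run over the whole line.
    rw [sqrt_eq_zero_of_nonpos (show e + c ≤ 0 by linarith), div_zero, ENNReal.ofReal_zero,
      zero_mul]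

/-- The map `(θ, v) ↦ (θ, e(θ, v))`. -/
def toLevels (m : ℝ) (p : ℝ × ℝ) : ℝ × ℝ := (p.1, energy (cosPot m) p)

lemma measurable_toLevels (m : ℝ) : Measurable (toLevels m) :=
  measurable_fst.prodMk (continuous_energy m).measurable

/-- Phase-space measure in the coordinates angle and energy. -/
lemma map_toLevels (m : ℝ) :
    phase.map (toLevels m) = ((volume.restrict (Icc 0 (2 * π))).prod volume).withDensity
      fun q : ℝ × ℝ => ENNReal.ofReal (√2 / √(q.2 + m * cos q.1)) := by
  ext s hs
  rw [Measure.map_apply (measurable_toLevels m) hs, withDensity_apply _ hs,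
    ← lintegral_indicator hs, phase, Measure.prod_apply (measurable_toLevels m hs),
    lintegral_prod _ (((measurable_inv_sqrt m).ennreal_ofReal.indicator hs).aemeasurable)]
  refine lintegral_congr fun θ => ?_
  have h1 := lintegral_sq (m * cos θ) ((Prod.mk θ ⁻¹' s).indicator 1)
  have h2 : ∀ v : ℝ, (Prod.mk θ ⁻¹' s).indicator (1 : ℝ → ENNReal) (v ^ 2 / 2 - m * cos θ) =
      (Prod.mk θ ⁻¹' (toLevels m ⁻¹' s)).indicator 1 v := by
    intro v
    have hiff : v ^ 2 / 2 - m * cos θ ∈ Prod.mk θ ⁻¹' s ↔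
        v ∈ Prod.mk θ ⁻¹' (toLevels m ⁻¹' s) := by
      simp only [mem_preimage, toLevels, energy_cosPot]
    by_cases hv : v ∈ Prod.mk θ ⁻¹' (toLevels m ⁻¹' s)
    · rw [indicator_of_mem hv, indicator_of_mem (hiff.2 hv)]; rfl
    · rw [indicator_of_notMem hv, indicator_of_notMem (mt hiff.1 hv)]
  simp only [h2] at h1
  rw [lintegral_indicator_one (measurable_prodMk_left (measurable_toLevels m hs))] at h1
  rw [h1]
  refine lintegral_congr fun e => ?_
  by_cases he : (θ, e) ∈ s
  · simp [indicator, he]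
  · simp [indicator, he]

lemma integral_withDensity_ofReal {α : Type*} [MeasurableSpace α] {μ : Measure α} {f : α → ℝ}
    (hf : Measurable f) (h0 : ∀ x, 0 ≤ f x) (g : α → ℝ) :
    (Integrable g (μ.withDensity fun x => ENNReal.ofReal (f x)) ↔
      Integrable (fun x => f x * g x) μ) ∧
    ∫ x, g x ∂(μ.withDensity fun x => ENNReal.ofReal (f x)) = ∫ x, f x * g x ∂μ := by
  have h : ∀ x, (f x).toNNReal • g x = f x * g x := fun x => by
    rw [NNReal.smul_def, Real.coe_toNNReal _ (h0 x), smul_eq_mul]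
  have h1 := integrable_withDensity_iff_integrable_smul (μ := μ) hf.real_toNNReal (g := g)
  have h2 := integral_withDensity_eq_integral_smul (μ := μ) hf.real_toNNReal g
  simp only [h] at h1 h2
  exact ⟨h1, h2⟩

lemma integral_toLevels {m : ℝ} {g : ℝ × ℝ → ℝ} (hg : Measurable g) :
    (Integrable (fun p => g (toLevels m p)) phase ↔
      Integrable (fun q : ℝ × ℝ => √2 / √(q.2 + m * cos q.1) * g q)
        ((volume.restrict (Icc 0 (2 * π))).prod volume)) ∧
    ∫ p, g (toLevels m p) ∂phase = ∫ q : ℝ × ℝ, √2 / √(q.2 + m * cos q.1) * g q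
      ∂((volume.restrict (Icc 0 (2 * π))).prod volume) := by
  have h := integral_withDensity_ofReal (μ := (volume.restrict (Icc 0 (2 * π))).prod volume)
    (measurable_inv_sqrt m) (fun q => by positivity) g
  rw [← map_toLevels] at h
  refine ⟨?_, ?_⟩
  · rw [← h.1]
    exact (integrable_map_measure hg.aestronglyMeasurable
      (measurable_toLevels m).aemeasurable).symm
  · rw [← h.2, integral_map (measurable_toLevels m).aemeasurable hg.aestronglyMeasurable]

/-- Almost every energy is avoided: level sets over a countable set of energies are null. -/
lemma ae_energy_notMem (m : ℝ) {N : Set ℝ} (hN : N.Countable) :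
    ∀ᵐ p ∂phase, energy (cosPot m) p ∉ N := by
  have h1 : (phase.map (toLevels m)) (univ ×ˢ N) = 0 := by
    rw [map_toLevels]
    refine withDensity_absolutelyContinuous _ _ ?_
    rw [Measure.prod_prod, hN.measure_zero, mul_zero]
  rw [Measure.map_apply (measurable_toLevels m) (MeasurableSet.univ.prod hN.measurableSet)] at h1
  rw [ae_iff]
  convert h1 using 2
  ext p; simp [toLevels]

/-! ### The variance over an orbit -/

lemma mul_inv_sqrt (x : ℝ) : √2 / √x * x = 2 * √(2 * x) / 2 := by
  rcases le_or_gt x 0 with h | h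
  · rw [sqrt_eq_zero_of_nonpos h, sqrt_eq_zero_of_nonpos (by linarith : 2 * x ≤ 0)]; simp
  · have h1 := sqrt_pos.2 h
    have h2 : √x * √x = x := mul_self_sqrt h.le
    rw [sqrt_mul two_pos.le]
    field_simp
    nlinarith

lemma orbitVar_eq {m e : ℝ} (hm : 0 < m) (h1 : -m < e) (h2 : e ≠ m) :
    IntervalIntegrable (fun θ => √2 / √(e + m * cos θ) * (cos θ - cosMean m e) ^ 2) volume
      0 (2 * π) ∧
    ∫ θ in (0 : ℝ)..(2 * π), √2 / √(e + m * cos θ) * (cos θ - cosMean m e) ^ 2 =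
      orbitVar m e := by
  set c := cosMean m e with hc
  have hω := orbitInt_pos hm h1 h2
  have hi1 := (intervalIntegrable_orbit (g := fun _ => 1) continuous_const hm h1 h2).2
  have hi2 := (intervalIntegrable_orbit (g := fun u => u) continuous_id hm h1 h2).2
  have hs : ∀ w : ℝ → ℝ, Continuous w → IntervalIntegrable
      (fun θ => w θ * (2 * √(2 * (e + m * cos θ)))) volume 0 (2 * π) := fun w hw =>
    Continuous.intervalIntegrable (by fun_prop) _ _
  -- One factor is written `cos θ - c = ((e + m cos θ) - (e + m c)) / m`. The part with `e + m cos
  -- θ` turns the inverse root into a root and yields weighted areas; the other part is a multiple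
  -- of `cos θ - c`, whose orbit integral vanishes by the choice of `c`.
  have hform : (fun θ => √2 / √(e + m * cos θ) * (cos θ - c) ^ 2) = fun θ =>
      ((1 / (2 * m)) * (cos θ * (2 * √(2 * (e + m * cos θ)))) -
        (c / (2 * m)) * (1 * (2 * √(2 * (e + m * cos θ))))) -
      (((e + m * c) / m) * (cos θ * (√2 / √(e + m * cos θ))) -
        ((e + m * c) / m * c) * (1 * (√2 / √(e + m * cos θ)))) := by
    ext θ
    have h := mul_inv_sqrt (e + m * cos θ)
    have h' : 2 * √(2 * (e + m * cos θ)) = 2 * (√2 / √(e + m * cos θ) * (e + m * cos θ)) := by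
      linarith
    rw [h']
    generalize √2 / √(e + m * cos θ) = r
    field_simp
    ring
  rw [hform]
  have ha := ((hs cos continuous_cos).const_mul (1 / (2 * m))).sub
    ((hs (fun _ => 1) continuous_const).const_mul (c / (2 * m)))
  have hb := (hi2.const_mul ((e + m * c) / m)).sub (hi1.const_mul ((e + m * c) / m * c))
  refine ⟨ha.sub hb, ?_⟩
  rw [intervalIntegral.integral_sub ha hb,
    intervalIntegral.integral_sub ((hs cos continuous_cos).const_mul _)
      ((hs (fun _ => 1) continuous_const).const_mul _),
    intervalIntegral.integral_sub (hi2.const_mul _) (hi1.const_mul _)]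
  have e1 (k : ℝ) (w : ℝ → ℝ) : ∫ θ in (0 : ℝ)..(2 * π), k * (w θ * (2 * √(2 * (e + m * cos θ)))) =
      k * slab w m e := intervalIntegral.integral_const_mul _ _
  have e2 (k : ℝ) (w : ℝ → ℝ) : ∫ θ in (0 : ℝ)..(2 * π), k * (w θ * (√2 / √(e + m * cos θ))) =
      k * orbitInt w m e := intervalIntegral.integral_const_mul _ _
  rw [e1 _ cos, e1 _ fun _ => 1, e2 _ cos, e2 _ fun _ => 1]
  have hcω : c * orbitInt (fun _ => 1) m e = orbitInt cos m e := by
    rw [hc, cosMean, div_mul_cancel₀ _ hω.ne']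
  rw [mul_assoc _ c, hcω, orbitVar, area_eq_slab]
  ring


/-! ### Differentiability of the rearranged profile -/

lemma differentiableAt_levelEnergy {m s : ℝ} (hm : 0 < m) (hs : 0 < s) (h : levelEnergy m s ≠ m) :
    DifferentiableAt ℝ (levelEnergy m) s := by
  have h0 := sqrt_pos.2 hm
  have h1 : invArea (s / √m) ≠ 1 := fun h1 => h (by rw [levelEnergy, h1, mul_one])
  have h2 : DifferentiableAt ℝ invArea (s / √m) :=
    (hasDerivAt_invArea (by positivity) h1).differentiableAt
  exact (DifferentiableAt.comp s (g := invArea) (f := fun s => s / √m) h2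
    (by fun_prop)).const_mul m

lemma differentiableAt_area {m e : ℝ} (hm : 0 < m) (h1 : -m < e) (h2 : e ≠ m) :
    DifferentiableAt ℝ (area (cosPot m)) e := by
  obtain ⟨h3, h4⟩ := div_mem_of_lt hm h1 h2
  have h : area (cosPot m) = fun e => √m * slab (fun _ => 1) 1 (e / m) := by
    ext e; rw [area_scaling hm, area_eq_slab]
  rw [h]
  exact (DifferentiableAt.comp e (g := slab (fun _ => 1) 1) (f := fun e => e / m)
    (hasDerivAt_slab_one h3 h4).1.differentiableAt (by fun_prop)).const_mul _

/-- The exceptional levels come from those of `F` and from the separatrix of `φ₀`. Countability,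
unlike nullity, survives arbitrary changes of variable and is what the fundamental theorem of
calculus for `Q ∘ a_φ` needs. -/
lemma IsSteadyState.exists_countable_profile {F : ℝ → ℝ} {eStar : WithTop ℝ} {m₀ : ℝ}
    (h : IsSteadyState F eStar m₀) : ∃ S : Set ℝ, S.Countable ∧
      ∀ s, 0 < s → s ∉ S → DifferentiableAt ℝ (profile F m₀) s := by
  obtain ⟨S, hS, hd⟩ := h.exists_countable
  refine ⟨area (cosPot m₀) '' (S ∪ {m₀}), (hS.union (countable_singleton _)).image _,
    fun s hs hns => ?_⟩
  have h1 : levelEnergy m₀ s ∉ S ∪ {m₀} := fun hmem =>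
    hns ⟨_, hmem, area_levelEnergy h.m₀_pos hs.le⟩
  exact DifferentiableAt.comp s (g := F) (f := levelEnergy m₀)
    (hd _ fun h2 => h1 (Or.inl h2))
    (differentiableAt_levelEnergy h.m₀_pos hs fun h2 => h1 (Or.inr h2))

section Layers

variable {Q : ℝ → ℝ}

lemma exists_countable_comp_area {S : Set ℝ} (hS : S.Countable)
    (hd : ∀ s, 0 < s → s ∉ S → DifferentiableAt ℝ Q s) {m : ℝ} (hm : 0 < m) :
    ∃ N : Set ℝ, N.Countable ∧ -m ∈ N ∧ m ∈ N ∧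
      ∀ e ∉ N, DifferentiableAt ℝ (Q ∘ area (cosPot m)) e := by
  refine ⟨{-m, m} ∪ levelEnergy m '' S, ((countable_singleton m).insert _).union (hS.image _),
    by simp, by simp, fun e he => ?_⟩
  have he1 : e ≠ -m := fun h => he (Or.inl (by simp [h]))
  have he2 : e ≠ m := fun h => he (Or.inl (by simp [h]))
  rcases lt_or_gt_of_ne he1 with h | h
  · refine (differentiableAt_const (Q 0)).congr_of_eventuallyEq ?_
    filter_upwards [Iio_mem_nhds h] with x hx
    rw [Function.comp_apply, area_eq_zero hm.le (le_of_lt hx)]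
  · refine DifferentiableAt.comp e (hd _ ?_ fun hmem => he (Or.inr ?_))
      (differentiableAt_area hm h he2)
    · rw [← area_eq_zero hm.le le_rfl]; exact (area_lt_iff le_rfl h.le).2 h
    · exact ⟨_, hmem, levelEnergy_area hm h.le⟩

lemma lt_levelEnergy_iff_of_pos {m s : ℝ} (hm : 0 < m) (hs : 0 < s) (e : ℝ) :
    e < levelEnergy m s ↔ area (cosPot m) e < s := by
  rcases le_or_gt (-m) e with h | h
  · exact lt_levelEnergy_iff hm h hs.le
  · rw [area_eq_zero hm.le h.le]
    exact iff_of_true (h.trans (neg_lt_levelEnergy hm hs)) hs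

lemma IsProfile.layers_Ioc (h : IsProfile Q) {a b : ℝ} (ha : 0 ≤ a) :
    h.layers (Ioc a b) = ENNReal.ofReal (Q a - Q b) := by
  rw [layers, Measure.restrict_apply measurableSet_Ioc,
    inter_eq_left.2 (show Ioc a b ⊆ Ioi 0 from fun x hx => lt_of_le_of_lt ha hx.1),
    StieltjesFunction.measure_Ioc]
  congr 1
  change -Q b - -Q a = _
  ring

lemma IsProfile.antitone_comp_area (h : IsProfile Q) (m : ℝ) :
    Antitone (Q ∘ area (cosPot m)) := h.antitone.comp_monotone (area_mono m)

/-- Both measures give `(a, b]` the drop of `Q ∘ a_φ` from `a` to `b`. For the density this is the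
fundamental theorem of calculus off a countable set, where integrability of the derivative comes
from monotonicity. -/
lemma IsProfile.map_levelEnergy (h : IsProfile Q) {S : Set ℝ} (hS : S.Countable)
    (hd : ∀ s, 0 < s → s ∉ S → DifferentiableAt ℝ Q s) {m : ℝ} (hm : 0 < m) :
    h.layers.map (levelEnergy m) =
      volume.withDensity fun e => ENNReal.ofReal (-deriv (Q ∘ area (cosPot m)) e) := by
  obtain ⟨N, hN, -, -, hdN⟩ := exists_countable_comp_area hS hd hm
  set G := Q ∘ area (cosPot m) with hG
  have hGc : Continuous G := h.continuous.comp (continuous_area_right m)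
  have hGa : Antitone G := h.antitone_comp_area m
  refine Measure.ext_of_Ioc _ _ fun a b hab => ?_
  have hii : IntervalIntegrable (fun e => -deriv G e) volume a b := by
    have := (hGa.neg.monotoneOn (uIcc a b)).intervalIntegrable_deriv
    refine this.congr fun e _ => ?_
    exact deriv.neg
  have hftc : ∫ e in a..b, -deriv G e = G a - G b := by
    rw [integral_eq_of_hasDerivAt_off_countable (fun e => -G e) (fun e => -deriv G e) hN
      hGc.neg.continuousOn (fun e he => (hdN e he.2).hasDerivAt.neg) hii]
    ring
  rw [withDensity_apply _ measurableSet_Ioc, ← ofReal_integral_eq_lintegral_ofReal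
    ((intervalIntegrable_iff_integrableOn_Ioc_of_le hab.le).1 hii)
    (Eventually.of_forall fun e => neg_nonneg.2 hGa.deriv_nonpos),
    ← intervalIntegral.integral_of_le hab.le, hftc,
    Measure.map_apply (continuous_levelEnergy m).measurable measurableSet_Ioc]
  rw [hG, Function.comp_apply, Function.comp_apply, ← h.layers_Ioc (area_nonneg _ _)]
  refine measure_congr ?_
  filter_upwards [h.ae_pos] with s hs
  refine propext ?_
  change a < levelEnergy m s ∧ levelEnergy m s ≤ b ↔ area (cosPot m) a < s ∧ s ≤ area (cosPot m) b
  rw [lt_levelEnergy_iff_of_pos hm hs, ← not_lt, lt_levelEnergy_iff_of_pos hm hs, not_lt]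

lemma IsProfile.integrable_levelVar (h : IsProfile Q) {m : ℝ} (hm : 0 < m) :
    Integrable (levelVar m) h.layers := by
  refine (h.integrable_id.div_const m).mono' (measurable_levelVar m).aestronglyMeasurable ?_
  filter_upwards [h.ae_pos] with s hs
  exact abs_levelVar_le hm hs.le

lemma IsProfile.integral_orbitVar (h : IsProfile Q) {S : Set ℝ} (hS : S.Countable)
    (hd : ∀ s, 0 < s → s ∉ S → DifferentiableAt ℝ Q s) {m : ℝ} (hm : 0 < m) :
    Integrable (fun e => -deriv (Q ∘ area (cosPot m)) e * orbitVar m e) ∧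
    ∫ e, -deriv (Q ∘ area (cosPot m)) e * orbitVar m e = ∫ s, levelVar m s ∂h.layers := by
  have h1 := integral_withDensity_ofReal (μ := volume)
    (f := fun e => -deriv (Q ∘ area (cosPot m)) e) (measurable_deriv _).neg
    (fun e => neg_nonneg.2 (h.antitone_comp_area m).deriv_nonpos) (orbitVar m)
  rw [← h.map_levelEnergy hS hd hm] at h1
  have hae : levelVar m =ᵐ[h.layers] fun s => orbitVar m (levelEnergy m s) := by
    filter_upwards [h.ae_pos] with s hs
    exact levelVar_eq hm hs.le
  have hmeas := (measurable_orbitVar m).aestronglyMeasurable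
    (μ := h.layers.map (levelEnergy m))
  refine ⟨?_, ?_⟩
  · rw [← h1.1, integrable_map_measure hmeas (continuous_levelEnergy m).aemeasurable]
    exact (h.integrable_levelVar hm).congr hae
  · rw [← h1.2, integral_map (continuous_levelEnergy m).aemeasurable hmeas]
    exact (integral_congr_ae hae).symm

/-- Fubini in angle and energy for the integrand of the second derivative. -/
lemma IsProfile.integral_deriv_mul_sq (h : IsProfile Q) {S : Set ℝ} (hS : S.Countable)
    (hd : ∀ s, 0 < s → s ∉ S → DifferentiableAt ℝ Q s) {m : ℝ} (hm : 0 < m) :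
    Integrable (fun p => deriv (Q ∘ area (cosPot m)) (energy (cosPot m) p) *
      (cos p.1 - cosMean m (energy (cosPot m) p)) ^ 2) phase ∧
    ∫ p, deriv (Q ∘ area (cosPot m)) (energy (cosPot m) p) *
      (cos p.1 - cosMean m (energy (cosPot m) p)) ^ 2 ∂phase =
        -∫ s, levelVar m s ∂h.layers := by
  obtain ⟨hi, he⟩ := h.integral_orbitVar hS hd hm
  have hneg : ∀ e, deriv (Q ∘ area (cosPot m)) e ≤ 0 := fun e =>
    (h.antitone_comp_area m).deriv_nonpos
  have hGm : Measurable (deriv (Q ∘ area (cosPot m))) := measurable_deriv _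
  generalize deriv (Q ∘ area (cosPot m)) = G at hi he hneg hGm ⊢
  have hgm : Measurable fun q : ℝ × ℝ => G q.2 * (cos q.1 - cosMean m q.2) ^ 2 := by
    have := measurable_cosMean m
    fun_prop
  have hlev := integral_toLevels (m := m) hgm
  have hfib : ∀ᵐ e : ℝ, IntegrableOn (fun θ => √2 / √(e + m * cos θ) *
      (G e * (cos θ - cosMean m e) ^ 2)) (Icc 0 (2 * π)) ∧
      ∫ θ in Icc 0 (2 * π), √2 / √(e + m * cos θ) * (G e * (cos θ - cosMean m e) ^ 2) =
        G e * orbitVar m e := by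
    have h1 : ∀ᵐ e : ℝ, e ∉ ({-m, m} : Set ℝ) :=
      ((countable_singleton m).insert (-m)).ae_notMem volume
    filter_upwards [h1] with e hne
    have he1 : e ≠ -m := fun h => hne (by simp [h])
    have he2 : e ≠ m := fun h => hne (by simp [h])
    rcases lt_or_gt_of_ne he1 with hlt | hgt
    · have hz : ∀ θ, √2 / √(e + m * cos θ) = 0 := fun θ => by
        rw [sqrt_eq_zero_of_nonpos (show e + m * cos θ ≤ 0 by nlinarith [cos_le_one θ]), div_zero]
      have hv : orbitVar m e = 0 := by
        rw [orbitVar, slab_eq_zero _ hm.le hlt.le, area_eq_zero hm.le hlt.le]; simp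
      simp only [hz, zero_mul, integral_zero, hv, mul_zero, and_true]
      exact integrableOn_zero
    · obtain ⟨h2, h3⟩ := orbitVar_eq hm hgt he2
      rw [intervalIntegrable_iff_integrableOn_Icc_of_le two_pi_nonneg] at h2
      rw [intervalIntegral.integral_of_le two_pi_nonneg, ← integral_Icc_eq_integral_Ioc] at h3
      have hcomm : ∀ θ, √2 / √(e + m * cos θ) * (G e * (cos θ - cosMean m e) ^ 2) =
          G e * (√2 / √(e + m * cos θ) * (cos θ - cosMean m e) ^ 2) := fun θ => by ring
      simp only [hcomm]
      exact ⟨h2.const_mul _, by rw [integral_const_mul, h3]⟩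
  have hI : Integrable (fun q : ℝ × ℝ => √2 / √(q.2 + m * cos q.1) *
      (G q.2 * (cos q.1 - cosMean m q.2) ^ 2))
      ((volume.restrict (Icc 0 (2 * π))).prod volume) := by
    have hmeas : Measurable fun q : ℝ × ℝ => √2 / √(q.2 + m * cos q.1) *
      (G q.2 * (cos q.1 - cosMean m q.2) ^ 2) := (measurable_inv_sqrt m).mul hgm
    rw [integrable_prod_iff' hmeas.aestronglyMeasurable]
    -- The integrand is nonpositive, so the fibre integral of its norm is `-G e * orbitVar m e`,
    -- already known to be integrable in `e`.
    refine ⟨hfib.mono fun e he => he.1, hi.congr ?_⟩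
    filter_upwards [hfib] with e he
    rw [neg_mul, ← he.2, ← integral_neg]
    refine integral_congr_ae (Eventually.of_forall fun θ => ?_)
    simp only
    rw [Real.norm_of_nonpos]
    exact mul_nonpos_of_nonneg_of_nonpos (by positivity)
      (mul_nonpos_of_nonpos_of_nonneg (hneg e) (sq_nonneg _))
  refine ⟨hlev.1.2 hI, ?_⟩
  refine hlev.2.trans ?_
  rw [integral_prod_symm _ hI, ← he, ← integral_neg]
  refine integral_congr_ae ?_
  filter_upwards [hfib] with e he
  rw [he.2]; ring

end Layers

/-! ### Regularity of the reduced energy of the steady state -/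

lemma sharp_comp_area {F : ℝ → ℝ} {eStar : WithTop ℝ} {m₀ : ℝ} (h : IsSteadyState F eStar m₀)
    (m : ℝ) : sharp (steady F m₀) ∘ area (cosPot m) = profile F m₀ ∘ area (cosPot m) := by
  ext e
  exact sharp_steady h.m₀_pos h.antitone h.continuous h.nonneg (area_nonneg _ _)

lemma reducedEnergy_eq {F : ℝ → ℝ} {eStar : WithTop ℝ} {m₀ : ℝ} (h : IsSteadyState F eStar m₀) :
    reducedEnergy (steady F m₀) = fun m => m ^ 2 / 2 + meanEnergy (profile F m₀) m := by
  ext m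
  simp only [reducedEnergy, meanEnergy, h.rearr_eq, layered]

lemma hasDerivWithinAt_reducedEnergy {F : ℝ → ℝ} {eStar : WithTop ℝ} {m₀ : ℝ}
    (h : IsSteadyState F eStar m₀) {m : ℝ} (hm : 0 ≤ m) :
    HasDerivWithinAt (reducedEnergy (steady F m₀)) (m - magnetization (profile F m₀) m)
      (Ici 0) m := by
  rw [reducedEnergy_eq h]
  have h1 : HasDerivAt (fun m : ℝ => m ^ 2 / 2) m m := by
    refine (((hasDerivAt_id m).pow 2).div_const 2).congr_deriv ?_
    simp
  exact (h1.hasDerivWithinAt.add (h.isProfile.hasDerivWithinAt_meanEnergy hm)).congr_deriv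
    (by ring)

lemma contDiffOn_one_reducedEnergy {F : ℝ → ℝ} {eStar : WithTop ℝ} {m₀ : ℝ}
    (h : IsSteadyState F eStar m₀) :
    ContDiffOn ℝ 1 (reducedEnergy (steady F m₀)) (Ici 0) := by
  rw [contDiffOn_one_iff_derivWithin (uniqueDiffOn_Ici 0)]
  refine ⟨fun m hm => (hasDerivWithinAt_reducedEnergy h hm).differentiableWithinAt, ?_⟩
  refine (continuousOn_id.sub h.isProfile.continuousOn_magnetization).congr fun m hm => ?_
  exact (hasDerivWithinAt_reducedEnergy h hm).derivWithin (uniqueDiffOn_Ici 0 m hm)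

lemma hasDerivAt_reducedEnergy {F : ℝ → ℝ} {eStar : WithTop ℝ} {m₀ : ℝ}
    (h : IsSteadyState F eStar m₀) {m : ℝ} (hm : 0 < m) :
    HasDerivAt (reducedEnergy (steady F m₀)) (m - magnetization (profile F m₀) m) m :=
  (hasDerivWithinAt_reducedEnergy h hm.le).hasDerivAt (Ici_mem_nhds hm)

lemma hasDerivAt_deriv_reducedEnergy {F : ℝ → ℝ} {eStar : WithTop ℝ} {m₀ : ℝ}
    (h : IsSteadyState F eStar m₀) {m : ℝ} (hm : 0 < m) :
    HasDerivAt (deriv (reducedEnergy (steady F m₀)))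
      (1 - ∫ s, levelVar m s ∂h.isProfile.layers) m := by
  refine ((hasDerivAt_id m).sub (h.isProfile.hasDerivAt_magnetization hm)).congr_of_eventuallyEq ?_
  filter_upwards [Ioi_mem_nhds hm] with n hn
  exact (hasDerivAt_reducedEnergy h hn).deriv

lemma contDiffOn_two_reducedEnergy {F : ℝ → ℝ} {eStar : WithTop ℝ} {m₀ : ℝ}
    (h : IsSteadyState F eStar m₀) :
    ContDiffOn ℝ 2 (reducedEnergy (steady F m₀)) (Ioi 0) := by
  rw [show (2 : WithTop ℕ∞) = 1 + 1 by norm_num, contDiffOn_succ_iff_deriv_of_isOpen isOpen_Ioi]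
  refine ⟨fun m hm => (hasDerivAt_reducedEnergy h hm).differentiableAt.differentiableWithinAt,
    by simp, ?_⟩
  rw [contDiffOn_one_iff_derivWithin (uniqueDiffOn_Ioi 0)]
  refine ⟨fun m hm =>
    (hasDerivAt_deriv_reducedEnergy h hm).differentiableAt.differentiableWithinAt, ?_⟩
  have hc : ContinuousOn (fun m => 1 - ∫ s, levelVar m s ∂h.isProfile.layers) (Ioi 0) :=
    fun m hm => (continuousAt_const.sub
      (h.isProfile.continuousAt_integral_levelVar hm)).continuousWithinAt
  refine hc.congr fun m hm => ?_
  exact (hasDerivAt_deriv_reducedEnergy h hm).hasDerivWithinAt.derivWithin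
    (uniqueDiffOn_Ioi 0 m hm)

/-- The minimum, the separatrix and the points where `Q ∘ a_φ` is not differentiable form a
countable set of energies, and the phase-space set above it is null. -/
lemma ae_good_energy {F : ℝ → ℝ} {eStar : WithTop ℝ} {m₀ : ℝ} (h : IsSteadyState F eStar m₀)
    {m : ℝ} (hm : 0 < m) : ∀ᵐ p ∂phase,
      (-m < energy (cosPot m) p ∧ energy (cosPot m) p ≠ m) ∧
      DifferentiableAt ℝ (profile F m₀ ∘ area (cosPot m)) (energy (cosPot m) p) := by
  obtain ⟨S, hS, hd⟩ := h.exists_countable_profile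
  obtain ⟨N, hN, hN1, hN2, hdN⟩ := exists_countable_comp_area hS hd hm
  filter_upwards [ae_energy_notMem m hN] with p hp
  exact ⟨⟨lt_of_le_of_ne (neg_le_energy hm.le p) fun h => hp (h ▸ hN1),
    fun h => hp (by rwa [h])⟩,
    hdN _ hp⟩

lemma integral_second_variation {F : ℝ → ℝ} {eStar : WithTop ℝ} {m₀ : ℝ}
    (h : IsSteadyState F eStar m₀) {m : ℝ} (hm : 0 < m) :
    Integrable (fun p => deriv (sharp (steady F m₀) ∘ area (cosPot m)) (energy (cosPot m) p) *
      (cos p.1 - orbitCos m (energy (cosPot m) p)) ^ 2) phase ∧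
    ∫ p, deriv (sharp (steady F m₀) ∘ area (cosPot m)) (energy (cosPot m) p) *
      (cos p.1 - orbitCos m (energy (cosPot m) p)) ^ 2 ∂phase =
        -∫ s, levelVar m s ∂h.isProfile.layers := by
  obtain ⟨S, hS, hd⟩ := h.exists_countable_profile
  obtain ⟨h1, h2⟩ := h.isProfile.integral_deriv_mul_sq hS hd hm
  have hae : (fun p : ℝ × ℝ => deriv (profile F m₀ ∘ area (cosPot m)) (energy (cosPot m) p) *
      (cos p.1 - cosMean m (energy (cosPot m) p)) ^ 2) =ᵐ[phase]
      fun p => deriv (profile F m₀ ∘ area (cosPot m)) (energy (cosPot m) p) *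
      (cos p.1 - orbitCos m (energy (cosPot m) p)) ^ 2 := by
    filter_upwards [ae_good_energy h hm] with p hp
    rw [orbitCos_eq_cosMean hm hp.1.1 hp.1.2]
  rw [sharp_comp_area h]
  exact ⟨h1.congr hae, by rw [← h2]; exact (integral_congr_ae hae).symm⟩

end HMF

end

theorem mainTheorem4 (F : ℝ → ℝ) (eStar : WithTop ℝ) (m₀ : ℝ)
    (h : HMF.IsSteadyState F eStar m₀) :
    -- the integral that defines the reduced energy converges
    (∀ m : ℝ, 0 ≤ m → Integrable
      (fun p => HMF.energy (HMF.cosPot m) p * HMF.rearr (HMF.steady F m₀) (HMF.cosPot m) p)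
      HMF.phase) ∧
    -- regularity
    ContDiffOn ℝ 1 (HMF.reducedEnergy (HMF.steady F m₀)) (Ici 0) ∧
    ContDiffOn ℝ 2 (HMF.reducedEnergy (HMF.steady F m₀)) (Ioi 0) ∧
    -- first derivative, one-sided at `m = 0`
    (∀ m : ℝ, 0 ≤ m →
      Integrable (fun p => HMF.rearr (HMF.steady F m₀) (HMF.cosPot m) p * cos p.1) HMF.phase ∧
      HasDerivWithinAt (HMF.reducedEnergy (HMF.steady F m₀))
        (m - ∫ p, HMF.rearr (HMF.steady F m₀) (HMF.cosPot m) p * cos p.1 ∂HMF.phase)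
        (Ici 0) m) ∧
    -- second derivative: almost everywhere the integrand is made of existing derivatives and
    -- quotients of convergent integrals, it is integrable, and the formula holds
    (∀ m : ℝ, 0 < m →
      (∀ᵐ p ∂HMF.phase,
        DifferentiableAt ℝ (HMF.sharp (HMF.steady F m₀) ∘ HMF.area (HMF.cosPot m))
          (HMF.energy (HMF.cosPot m) p) ∧
        IntervalIntegrable
          (fun θ' => 1 / √(HMF.energy (HMF.cosPot m) p + m * cos θ')) volume
          0 (HMF.angle m (HMF.energy (HMF.cosPot m) p)) ∧
        0 < HMF.orbitWeight m (HMF.energy (HMF.cosPot m) p)) ∧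
      Integrable
        (fun p => deriv (HMF.sharp (HMF.steady F m₀) ∘ HMF.area (HMF.cosPot m))
            (HMF.energy (HMF.cosPot m) p) *
          (cos p.1 - HMF.orbitCos m (HMF.energy (HMF.cosPot m) p)) ^ 2) HMF.phase ∧
      HasDerivAt (deriv (HMF.reducedEnergy (HMF.steady F m₀)))
        (1 + ∫ p, deriv (HMF.sharp (HMF.steady F m₀) ∘ HMF.area (HMF.cosPot m))
            (HMF.energy (HMF.cosPot m) p) *
          (cos p.1 - HMF.orbitCos m (HMF.energy (HMF.cosPot m) p)) ^ 2 ∂HMF.phase) m) := by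
  have hP := h.isProfile
  refine ⟨fun m hm => ?_, HMF.contDiffOn_one_reducedEnergy h, HMF.contDiffOn_two_reducedEnergy h,
    fun m hm => ?_, fun m hm => ⟨?_, (HMF.integral_second_variation h hm).1, ?_⟩⟩
  · simp only [h.rearr_eq]
    exact hP.integrable_energy_mul hm m
  · simp only [h.rearr_eq, mul_comm _ (cos _)]
    exact ⟨hP.integrable_cos_mul hm, HMF.hasDerivWithinAt_reducedEnergy h hm⟩
  · filter_upwards [HMF.ae_good_energy h hm] with p hp
    rw [HMF.sharp_comp_area h]
    exact ⟨hp.2, (HMF.integral_angle (g := fun _ => 1) continuous_const hm hp.1.1 hp.1.2).1,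
      HMF.orbitWeight_pos hm hp.1.1 hp.1.2⟩
  · rw [(HMF.integral_second_variation h hm).2, ← sub_eq_add_neg]
    exact HMF.hasDerivAt_deriv_reducedEnergy h hm
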